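/- Let $(\Omega,\mathcal F,\mathbb P)$ be a complete probability space and let $\alpha=(\alpha_t)_{t\ge 0}$ be a continuous-time irreducible Markov chain with càdlàg paths on it, with finite state space $\mathcal S=\{1,\dots,D\}$ and generator $\Pi=(\pi_{ij})_{i,j\in\mathcal S}$, where $\pi_{ij}\ge 0$ for $i\ne j$ and $\pi_{ii}=-\sum_{j\ne i}\pi_{ij}$. Let $\mathbb F=(\mathcal F_t)_{t\ge 0}$ be the natural filtration of $\alpha$ augmented by all $\mathbb P$-null sets of $\mathcal F$, and let $L^2_{\mathbb F}(\mathbb R^n)$ be the set of $\mathbb R^n$-valued $\mathbb F$-progressively measurable processes $\varphi$ with $\mathbb E\int_0^\infty|\varphi(t)|^2\,dt<\infty$. Let $A(1),\dots,A(D)\in\mathbb R^{n\times n}$ satisfy Condition (A): there are symmetric positive definite matrices $P(1),\dots,P(D)\in\mathbb R^{n\times n}$ such that $$P(i)A(i)+A(i)^\top P(i)+\sum_{j=1}^D\pi_{ij}P(j)<0\quad\text{(negative definite) for every } i\in\mathcal S.$$ Let $b\in L^2_{\mathbb F}(\mathbb R^n)$, $x\in\mathbb R^n$, $i\in\mathcal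 S$, and suppose that $\alpha_0=i$ almost surely. Then the equation $$\dot X(t)=A(\alpha_t)X(t)+b(t),\quad t\ge 0,\qquad X(0)=x,$$ understood in the sense that almost surely, for all $t\ge0$, the process $s\mapsto A(\alpha_s)X(s)+b(s)$ is integrable on $[0,t]$ and $X(t)=x+\int_0^t\big(A(\alpha_s)X(s)+b(s)\big)\,ds$, has a solution $X\in L^2_{\mathbb F}(\mathbb R^n)$, and this solution is unique up to indistinguishability: every solution $Y$ satisfies $\mathbb P(Y(t)=X(t)\text{ for all }t\ge 0)=1$. -/

import Mathlib

open MeasureTheory ProbabilityTheory Filter Topology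
open scoped NNReal ENNReal

noncomputable section

namespace RegimeSwitching

/-- The natural filtration of a process `α` with finitely many states, augmented by all the
`P`-null sets of the underlying σ-algebra. -/
def augmentedFiltration {Ω : Type*} {mΩ : MeasurableSpace Ω} (P : Measure Ω) {D : ℕ}
    (α : ℝ≥0 → Ω → Fin D) (hα : ∀ t, Measurable (α t)) : Filtration ℝ≥0 mΩ where
  seq t := Filtration.natural α (fun s => (hα s).stronglyMeasurable) t ⊔
    MeasurableSpace.generateFrom {N : Set Ω | MeasurableSet N ∧ P N = 0}
  mono' _ _ hst := sup_le_sup_right ((Filtration.natural α _).mono hst) _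
  le' t := sup_le ((Filtration.natural α _).le t)
    (MeasurableSpace.generateFrom_le fun _ hN => hN.1)

/-- `Q` is the generator (transition rate matrix) of a Markov chain on `Fin D`. -/
structure IsGenerator {D : ℕ} (Q : Matrix (Fin D) (Fin D) ℝ) : Prop where
  nonneg : ∀ i j, i ≠ j → 0 ≤ Q i j
  diag : ∀ i, Q i i = -∑ j ∈ Finset.univ.erase i, Q i j

/-- Irreducibility of the chain with generator `Q`: every state can be reached from every other
one through finitely many transitions of positive rate. -/
def IsIrreducibleGenerator {D : ℕ} (Q : Matrix (Fin D) (Fin D) ℝ) : Prop :=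
  ∀ i j, Relation.ReflTransGen (fun k l => k ≠ l ∧ 0 < Q k l) i j

/-- `α` is a continuous-time, irreducible Markov chain on `Fin D` with generator `Q` and almost
surely càdlàg paths. The Markov property is that, conditionally on the past up to time `s`, the
state at time `t ≥ s` has law given by the row `α s` of the transition matrix `exp ((t - s) Q)`. -/
structure IsMarkovChain {Ω : Type*} {mΩ : MeasurableSpace Ω} (P : Measure Ω) {D : ℕ}
    (Q : Matrix (Fin D) (Fin D) ℝ) (α : ℝ≥0 → Ω → Fin D) (hα : ∀ t, Measurable (α t)) :
    Prop where
  generator : IsGenerator Q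
  irreducible : IsIrreducibleGenerator Q
  markov : ∀ s t : ℝ≥0, s ≤ t → ∀ j : Fin D,
    P[(α t ⁻¹' {j}).indicator (fun _ => (1 : ℝ)) | augmentedFiltration P α hα s] =ᵐ[P]
      fun ω => NormedSpace.exp (((t : ℝ) - (s : ℝ)) • Q) (α s ω) j
  cadlag : ∀ᵐ ω ∂P, ∀ t : ℝ≥0, ContinuousWithinAt (fun s => α s ω) (Set.Ioi t) t ∧
    ∃ j : Fin D, Tendsto (fun s => α s ω) (𝓝[<] t) (𝓝 j)

/-- The space `L²_𝔽(ℝⁿ)`: progressively measurable processes `φ` with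
`E ∫₀^∞ |φ(t)|² dt < ∞`. -/
def MemL2F {Ω : Type*} {mΩ : MeasurableSpace Ω} (P : Measure Ω) (𝔽 : Filtration ℝ≥0 mΩ) {n : ℕ}
    (φ : ℝ≥0 → Ω → EuclideanSpace ℝ (Fin n)) : Prop :=
  IsProgressive 𝔽 φ ∧ ∫⁻ ω, (∫⁻ t in Set.Ici (0 : ℝ), ‖φ t.toNNReal ω‖ₑ ^ 2) ∂P < ∞

/-- Condition (A): there are symmetric positive definite matrices `M i` with
`M i A i + (A i)ᵀ M i + ∑ j, q_{ij} M j < 0` for every state `i`. -/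
def ConditionA {D n : ℕ} (Q : Matrix (Fin D) (Fin D) ℝ)
    (A : Fin D → Matrix (Fin n) (Fin n) ℝ) : Prop :=
  ∃ M : Fin D → Matrix (Fin n) (Fin n) ℝ, (∀ i, (M i).PosDef) ∧
    ∀ i, (-(M i * A i + (A i).transpose * M i + ∑ j, Q i j • M j)).PosDef

/-- `X` solves `Ẋ(t) = A(α_t) X(t) + b(t)`, `X(0) = x`: almost surely, for all `t ≥ 0` the right
hand side is integrable on `[0, t]` and `X(t) = x + ∫₀ᵗ (A(α_s) X(s) + b(s)) ds`.
Processes are indexed by `ℝ≥0`, and `s.toNNReal` is the real time `s ≥ 0` as such an index.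
No measurability in `ω` is asked for here, so that uniqueness holds among all processes. -/
def IsSolution {Ω : Type*} {mΩ : MeasurableSpace Ω} (P : Measure Ω) {D n : ℕ}
    (A : Fin D → Matrix (Fin n) (Fin n) ℝ) (α : ℝ≥0 → Ω → Fin D)
    (b : ℝ≥0 → Ω → EuclideanSpace ℝ (Fin n)) (x : EuclideanSpace ℝ (Fin n))
    (X : ℝ≥0 → Ω → EuclideanSpace ℝ (Fin n)) : Prop :=
  ∀ᵐ ω ∂P, ∀ t : ℝ≥0,
    IntervalIntegrable (fun s : ℝ =>
      (A (α s.toNNReal ω)).toEuclideanLin (X s.toNNReal ω) + b s.toNNReal ω) volume 0 t ∧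
    X t ω = x + ∫ s in (0 : ℝ)..t,
      ((A (α s.toNNReal ω)).toEuclideanLin (X s.toNNReal ω) + b s.toNNReal ω)

end RegimeSwitching

end

/-!
Existence and uniqueness are pathwise: along a path of the chain the equation is a linear Volterra
equation with bounded coefficient, solved by the Picard series, and each partial sum of that series
is progressively measurable. Square integrability on `[0, ∞)` comes from the Lyapunov function
`⟪V (α t) (X t), X t⟫`. By the Kolmogorov forward equation, the increments of the indicators
`1_{α t = k}` minus their `Q`-drift have mean zero against every variable known at the start of the
increment. Integrating by parts against the absolutely continuous functions `⟪V k (X t), X t⟫`,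
which avoids stochastic integration, gives a mean energy balance in which condition (A) makes the
drift at most `-δ ‖X‖²`, up to the forcing; Young's inequality then bounds `E ∫ ‖X‖²` over `[0, T]`
uniformly in `T`.
-/

noncomputable section

namespace RegimeSwitching

section Pathwise

variable {E : Type*} [NormedAddCommGroup E]

theorem intervalIntegrable_comp_toNNReal {f : ℝ≥0 → E}
    (hf : ∀ t : ℝ≥0, IntervalIntegrable (fun s : ℝ => f s.toNNReal) volume 0 t) (u v : ℝ) :
    IntervalIntegrable (fun s : ℝ => f s.toNNReal) volume u v := by
  have from_zero (u : ℝ) : IntervalIntegrable (fun s : ℝ => f s.toNNReal) volume 0 u := by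
    rcases le_total 0 u with hu | hu
    · simpa [hu] using hf u.toNNReal
    · refine (intervalIntegrable_const (c := f 0)).congr fun s hs => ?_
      rw [Set.uIoc_of_ge hu] at hs
      simp [Real.toNNReal_of_nonpos hs.2]
  exact (from_zero u).symm.trans (from_zero v)

theorem exists_norm_le_of_continuous {y : ℝ≥0 → E} (hy : Continuous y) (T : ℝ≥0) :
    ∃ C, ∀ t ≤ T, ‖y t‖ ≤ C := by
  obtain ⟨C, hC⟩ := isCompact_Icc.exists_bound_of_continuousOn (s := Set.Icc 0 T) hy.continuousOn
  exact ⟨C, fun t ht => hC t ⟨zero_le, ht⟩⟩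

variable [NormedSpace ℝ E]

theorem continuous_integral_comp_toNNReal {f : ℝ≥0 → E}
    (hf : ∀ t : ℝ≥0, IntervalIntegrable (fun s : ℝ => f s.toNNReal) volume 0 t) :
    Continuous fun t : ℝ≥0 => ∫ s in (0 : ℝ)..t, f s.toNNReal :=
  (intervalIntegral.continuous_primitive (intervalIntegrable_comp_toNNReal hf) 0).comp
    NNReal.continuous_coe

theorem continuous_of_eq_add_integral {f F : ℝ≥0 → E} {x : E}
    (hf : ∀ t : ℝ≥0, IntervalIntegrable (fun s : ℝ => f s.toNNReal) volume 0 t)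
    (hF : ∀ t : ℝ≥0, F t = x + ∫ s in (0 : ℝ)..t, f s.toNNReal) : Continuous F := by
  rw [funext hF]
  exact continuous_const.add (continuous_integral_comp_toNNReal hf)

/-- The Volterra operator `f ↦ ∫₀ᵗ a(s) f(s) ds`, whose fixed points, after adding a forcing term,
are the solutions of a linear equation with coefficient `a`. Time runs through `ℝ≥0`, and the
integration variable is converted by `Real.toNNReal`. -/
def volterra (a : ℝ≥0 → E →L[ℝ] E) (f : ℝ≥0 → E) (t : ℝ≥0) : E :=
  ∫ s in (0 : ℝ)..t, a s.toNNReal (f s.toNNReal)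

/-- The sum of the Picard series `∑ₖ Vᵏ y`, where `V` is the Volterra operator with coefficient
`a`. -/
def picardSum (a : ℝ≥0 → E →L[ℝ] E) (y : ℝ≥0 → E) (t : ℝ≥0) : E :=
  ∑' k, (volterra a)^[k] y t

variable {a : ℝ≥0 → E →L[ℝ] E} {K : ℝ}

theorem norm_volterra_le (haK : ∀ t, ‖a t‖ ≤ K) {f : ℝ≥0 → E} {C : ℝ} {k : ℕ} {t : ℝ≥0}
    (hf : ∀ s ≤ t, ‖f s‖ ≤ C * (K * s) ^ k / k.factorial) :
    ‖volterra a f t‖ ≤ C * (K * t) ^ (k + 1) / (k + 1).factorial := by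
  have integrand_le : ∀ s ∈ Set.Ioc (0 : ℝ) t, ‖a s.toNNReal (f s.toNNReal)‖ ≤
      K * (C * K ^ k / k.factorial) * s ^ k := by
    intro s hs
    have hfs := hf s.toNNReal (Real.toNNReal_le_iff_le_coe.2 hs.2)
    rw [Real.coe_toNNReal s hs.1.le] at hfs
    calc ‖a s.toNNReal (f s.toNNReal)‖
        ≤ K * (C * (K * s) ^ k / k.factorial) := (a s.toNNReal).le_of_opNorm_le_of_le (haK _) hfs
      _ = K * (C * K ^ k / k.factorial) * s ^ k := by rw [mul_pow]; ring
  calc ‖volterra a f t‖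
      ≤ ∫ s in (0 : ℝ)..t, K * (C * K ^ k / k.factorial) * s ^ k :=
        intervalIntegral.norm_integral_le_of_norm_le t.coe_nonneg (ae_of_all _ integrand_le)
          (Continuous.intervalIntegrable (by fun_prop) _ _)
    _ = C * (K * t) ^ (k + 1) / (k + 1).factorial := by
        rw [intervalIntegral.integral_const_mul, integral_pow, Nat.factorial_succ, mul_pow]
        push_cast
        rw [zero_pow k.succ_ne_zero, sub_zero]
        field_simp
        ring

theorem norm_iterate_volterra_le (haK : ∀ t, ‖a t‖ ≤ K) {y : ℝ≥0 → E} {C : ℝ} {T : ℝ≥0}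
    (hy : ∀ t ≤ T, ‖y t‖ ≤ C) (k : ℕ) :
    ∀ t ≤ T, ‖(volterra a)^[k] y t‖ ≤ C * (K * t) ^ k / k.factorial := by
  induction k with
  | zero => simpa using hy
  | succ k ih =>
    intro t ht
    rw [Function.iterate_succ_apply']
    exact norm_volterra_le haK fun s hs => ih s (hs.trans ht)

theorem norm_picardSum_le (haK : ∀ t, ‖a t‖ ≤ K) {y : ℝ≥0 → E} {C : ℝ} {t : ℝ≥0}
    (hy : ∀ s ≤ t, ‖y s‖ ≤ C) : ‖picardSum a y t‖ ≤ C * Real.exp (K * t) := by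
  have exp_series : HasSum (fun k => C * ((K * t) ^ k / k.factorial)) (C * Real.exp (K * t)) := by
    rw [Real.exp_eq_exp_ℝ]
    exact (NormedSpace.expSeries_div_hasSum_exp (K * (t : ℝ))).mul_left C
  refine tsum_of_norm_bounded exp_series fun k => ?_
  rw [← mul_div_assoc]
  exact norm_iterate_volterra_le haK hy k t le_rfl

theorem eq_zero_of_eq_volterra (haK : ∀ t, ‖a t‖ ≤ K) {f : ℝ≥0 → E} (hcont : Continuous f)
    (hf : f = volterra a f) : f = 0 := by
  funext t
  obtain ⟨C, hC⟩ := exists_norm_le_of_continuous hcont t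
  have hlim : Tendsto (fun k : ℕ => C * (K * t) ^ k / k.factorial) atTop (𝓝 0) := by
    simpa [mul_div_assoc] using
      (FloorSemiring.tendsto_pow_div_factorial_atTop (K * (t : ℝ))).const_mul C
  refine norm_le_zero_iff.1 (ge_of_tendsto' hlim fun k => ?_)
  have iterate_eq : (volterra a)^[k] f = f := Function.iterate_fixed hf.symm k
  simpa only [iterate_eq] using norm_iterate_volterra_le haK hC k t le_rfl

theorem aestronglyMeasurable_apply_toNNReal (ha : StronglyMeasurable a) {f : ℝ≥0 → E}
    (hf : StronglyMeasurable f) (μ : Measure ℝ) :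
    AEStronglyMeasurable (fun s : ℝ => a s.toNNReal (f s.toNNReal)) μ :=
  ((isBoundedBilinearMap_apply.continuous.comp_stronglyMeasurable
    (ha.prodMk hf)).comp_measurable measurable_real_toNNReal).aestronglyMeasurable

theorem intervalIntegrable_apply_toNNReal (ha : StronglyMeasurable a) (haK : ∀ t, ‖a t‖ ≤ K)
    {f : ℝ≥0 → E} (hf : StronglyMeasurable f) {C : ℝ} {T : ℝ≥0} (hfC : ∀ t ≤ T, ‖f t‖ ≤ C) :
    IntervalIntegrable (fun s : ℝ => a s.toNNReal (f s.toNNReal)) volume 0 T := by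
  refine (intervalIntegrable_const (c := K * C)).mono_fun
    (aestronglyMeasurable_apply_toNNReal ha hf _) ?_
  filter_upwards [ae_restrict_mem measurableSet_uIoc] with s hs
  rw [Set.uIoc_of_le T.coe_nonneg] at hs
  exact ((a s.toNNReal).le_of_opNorm_le_of_le (haK _)
    (hfC _ (Real.toNNReal_le_iff_le_coe.2 hs.2))).trans (le_abs_self _)

theorem continuous_volterra (ha : StronglyMeasurable a) (haK : ∀ t, ‖a t‖ ≤ K) {f : ℝ≥0 → E}
    (hf : Continuous f) : Continuous (volterra a f) := by
  refine continuous_integral_comp_toNNReal (f := fun s => a s (f s)) fun t => ?_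
  obtain ⟨C, hC⟩ := exists_norm_le_of_continuous hf t
  exact intervalIntegrable_apply_toNNReal ha haK hf.stronglyMeasurable hC

theorem continuous_iterate_volterra (ha : StronglyMeasurable a) (haK : ∀ t, ‖a t‖ ≤ K)
    {y : ℝ≥0 → E} (hy : Continuous y) (k : ℕ) : Continuous ((volterra a)^[k] y) := by
  induction k with
  | zero => exact hy
  | succ k ih =>
    rw [Function.iterate_succ_apply']
    exact continuous_volterra ha haK ih

variable [CompleteSpace E]

theorem hasSum_iterate_volterra (haK : ∀ t, ‖a t‖ ≤ K) {y : ℝ≥0 → E} (hy : Continuous y)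
    (t : ℝ≥0) : HasSum (fun k => (volterra a)^[k] y t) (picardSum a y t) := by
  obtain ⟨C, hC⟩ := exists_norm_le_of_continuous hy t
  refine (Summable.of_norm_bounded ((Real.summable_pow_div_factorial (K * t)).mul_left C)
    fun k => ?_).hasSum
  rw [← mul_div_assoc]
  exact norm_iterate_volterra_le haK hC k t le_rfl

theorem stronglyMeasurable_picardSum (ha : StronglyMeasurable a) (haK : ∀ t, ‖a t‖ ≤ K)
    {y : ℝ≥0 → E} (hy : Continuous y) : StronglyMeasurable (picardSum a y) :=
  StronglyMeasurable.hasSum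
    (fun k => (continuous_iterate_volterra ha haK hy k).stronglyMeasurable)
    (hasSum_iterate_volterra haK hy)

theorem intervalIntegrable_apply_picardSum (ha : StronglyMeasurable a) (haK : ∀ t, ‖a t‖ ≤ K)
    {y : ℝ≥0 → E} (hy : Continuous y) (t : ℝ≥0) :
    IntervalIntegrable (fun s : ℝ => a s.toNNReal (picardSum a y s.toNNReal)) volume 0 t := by
  have hK : 0 ≤ K := (norm_nonneg _).trans (haK 0)
  obtain ⟨C, hC⟩ := exists_norm_le_of_continuous hy t
  have hC0 : 0 ≤ C := (norm_nonneg _).trans (hC 0 zero_le)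
  refine intervalIntegrable_apply_toNNReal ha haK (stronglyMeasurable_picardSum ha haK hy)
    (C := C * Real.exp (K * t)) fun s hs => ?_
  refine (norm_picardSum_le haK fun r hr => hC r (hr.trans hs)).trans ?_
  have : (s : ℝ) ≤ t := hs
  gcongr

theorem picardSum_eq_add_volterra (ha : StronglyMeasurable a) (haK : ∀ t, ‖a t‖ ≤ K)
    {y : ℝ≥0 → E} (hy : Continuous y) (t : ℝ≥0) :
    picardSum a y t = y t + volterra a (picardSum a y) t := by
  have hK : 0 ≤ K := (norm_nonneg _).trans (haK 0)
  obtain ⟨C, hC⟩ := exists_norm_le_of_continuous hy t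
  have hC0 : 0 ≤ C := (norm_nonneg _).trans (hC 0 zero_le)
  have shifted_series :
      HasSum (fun k => (volterra a)^[k + 1] y t) (volterra a (picardSum a y) t) := by
    simp only [Function.iterate_succ_apply']
    refine intervalIntegral.hasSum_integral_of_dominated_convergence
      (fun k _ => K * (C * ((K * t) ^ k / k.factorial))) (fun k =>
        aestronglyMeasurable_apply_toNNReal ha
          (continuous_iterate_volterra ha haK hy k).stronglyMeasurable _)
      (fun k => ae_of_all _ fun s hs => ?_)
      (ae_of_all _ fun _ _ => ((Real.summable_pow_div_factorial _).mul_left C).mul_left K)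
      intervalIntegrable_const
      (ae_of_all _ fun s _ => (hasSum_iterate_volterra haK hy _).mapL (a s.toNNReal))
    rw [Set.uIoc_of_le t.coe_nonneg] at hs
    have hst : s.toNNReal ≤ t := Real.toNNReal_le_iff_le_coe.2 hs.2
    refine (a s.toNNReal).le_of_opNorm_le_of_le (haK _)
      ((norm_iterate_volterra_le haK hC k _ hst).trans ?_)
    rw [mul_div_assoc]
    gcongr
  rw [← sub_eq_iff_eq_add']
  simpa using ((hasSum_nat_add_iff' 1).2 (hasSum_iterate_volterra haK hy t)).unique shifted_series

end Pathwise

section SolutionPath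

theorem sq_intervalIntegral_le {g : ℝ → ℝ} {T : ℝ} (hT : 0 ≤ T)
    (hg : IntervalIntegrable g volume 0 T)
    (hg₂ : IntervalIntegrable (fun s => g s ^ 2) volume 0 T) :
    (∫ s in (0 : ℝ)..T, g s) ^ 2 ≤ T * ∫ s in (0 : ℝ)..T, g s ^ 2 := by
  rcases hT.eq_or_lt with rfl | hT'
  · simp
  set I := ∫ s in (0 : ℝ)..T, g s with hI
  have amgm : ∫ s in (0 : ℝ)..T, 2 * T * I * g s ≤ ∫ s in (0 : ℝ)..T, (I ^ 2 + T ^ 2 * g s ^ 2) :=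
    intervalIntegral.integral_mono hT (hg.const_mul _)
      (intervalIntegrable_const.add (hg₂.const_mul _))
      fun s => by nlinarith [sq_nonneg (T * g s - I)]
  rw [intervalIntegral.integral_const_mul, intervalIntegral.integral_add intervalIntegrable_const
    (hg₂.const_mul _), intervalIntegral.integral_const_mul, intervalIntegral.integral_const,
    ← hI, sub_zero, smul_eq_mul] at amgm
  refine le_of_mul_le_mul_left ?_ hT'
  linarith

variable {E : Type*} [NormedAddCommGroup E] [NormedSpace ℝ E]

/-- `f` solves `f' = a f + β`, `f 0 = x` on the half line, in integrated form. This is the pathwise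
notion of solution of a switching system, the coefficient being frozen along one path. -/
def IsSolutionPath (a : ℝ≥0 → E →L[ℝ] E) (β : ℝ≥0 → E) (x : E) (f : ℝ≥0 → E) : Prop :=
  ∀ t : ℝ≥0,
    IntervalIntegrable (fun s : ℝ => a s.toNNReal (f s.toNNReal) + β s.toNNReal) volume 0 t ∧
    f t = x + ∫ s in (0 : ℝ)..t, (a s.toNNReal (f s.toNNReal) + β s.toNNReal)

namespace IsSolutionPath

variable {a : ℝ≥0 → E →L[ℝ] E} {β : ℝ≥0 → E} {x : E} {f g : ℝ≥0 → E} {K : ℝ}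

theorem intervalIntegrable (hf : IsSolutionPath a β x f) (s t : ℝ) :
    IntervalIntegrable (fun u : ℝ => a u.toNNReal (f u.toNNReal) + β u.toNNReal) volume s t :=
  intervalIntegrable_comp_toNNReal (f := fun u => a u (f u) + β u) (fun t => (hf t).1) s t

theorem continuous (hf : IsSolutionPath a β x f) : Continuous f :=
  continuous_of_eq_add_integral (f := fun u => a u (f u) + β u) (fun t => (hf t).1)
    fun t => (hf t).2

theorem apply_zero (hf : IsSolutionPath a β x f) : f 0 = x := by
  simpa using (hf 0).2

theorem eq (haK : ∀ t, ‖a t‖ ≤ K) (hf : IsSolutionPath a β x f) (hg : IsSolutionPath a β x g) :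
    f = g := by
  refine sub_eq_zero.1 (eq_zero_of_eq_volterra haK (hf.continuous.sub hg.continuous) ?_)
  funext t
  rw [Pi.sub_apply, (hf t).2, (hg t).2, add_sub_add_left_eq_sub,
    ← intervalIntegral.integral_sub (hf t).1 (hg t).1]
  simp only [volterra, Pi.sub_apply, map_sub, add_sub_add_right_eq_sub]

variable [CompleteSpace E]

theorem picardSum (ha : StronglyMeasurable a) (haK : ∀ t, ‖a t‖ ≤ K)
    (hβ : ∀ t : ℝ≥0, IntervalIntegrable (fun s : ℝ => β s.toNNReal) volume 0 t) (x : E) :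
    IsSolutionPath a β x (picardSum a fun t => x + ∫ s in (0 : ℝ)..t, β s.toNNReal) := by
  have forcing_continuous : Continuous fun t : ℝ≥0 => x + ∫ s in (0 : ℝ)..t, β s.toNNReal :=
    continuous_const.add (continuous_integral_comp_toNNReal hβ)
  intro t
  have apply_integrable := intervalIntegrable_apply_picardSum ha haK forcing_continuous t
  refine ⟨apply_integrable.add (hβ t), ?_⟩
  rw [picardSum_eq_add_volterra ha haK forcing_continuous,
    intervalIntegral.integral_add apply_integrable (hβ t), volterra]
  abel

theorem norm_le (ha : StronglyMeasurable a) (haK : ∀ t, ‖a t‖ ≤ K)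
    (hβ : ∀ t : ℝ≥0, IntervalIntegrable (fun s : ℝ => β s.toNNReal) volume 0 t)
    (hf : IsSolutionPath a β x f) {t T : ℝ≥0} (ht : t ≤ T) :
    ‖f t‖ ≤ (‖x‖ + ∫ s in (0 : ℝ)..T, ‖β s.toNNReal‖) * Real.exp (K * T) := by
  have hK : 0 ≤ K := (norm_nonneg _).trans (haK 0)
  have norm_forcing_le : ∀ s ≤ t, ‖x + ∫ r in (0 : ℝ)..s, β r.toNNReal‖ ≤
      ‖x‖ + ∫ r in (0 : ℝ)..T, ‖β r.toNNReal‖ := by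
    intro s hs
    refine (norm_add_le _ _).trans (add_le_add_right ?_ _)
    refine (intervalIntegral.norm_integral_le_integral_norm s.coe_nonneg).trans ?_
    exact intervalIntegral.integral_mono_interval le_rfl s.coe_nonneg
      (NNReal.coe_le_coe.2 (hs.trans ht)) (ae_of_all _ fun _ => norm_nonneg _) (hβ T).norm
  have integral_nonneg : 0 ≤ ∫ r in (0 : ℝ)..T, ‖β r.toNNReal‖ :=
    intervalIntegral.integral_nonneg T.coe_nonneg fun _ _ => norm_nonneg _
  have : (t : ℝ) ≤ T := ht
  rw [hf.eq haK (picardSum ha haK hβ x)]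
  refine (norm_picardSum_le haK norm_forcing_le).trans ?_
  gcongr

theorem sq_norm_le (ha : StronglyMeasurable a) (haK : ∀ t, ‖a t‖ ≤ K)
    (hβ : ∀ t : ℝ≥0, IntervalIntegrable (fun s : ℝ => β s.toNNReal) volume 0 t)
    (hβ₂ : ∀ t : ℝ≥0, IntervalIntegrable (fun s : ℝ => ‖β s.toNNReal‖ ^ 2) volume 0 t)
    (hf : IsSolutionPath a β x f) {t T : ℝ≥0} (ht : t ≤ T) :
    ‖f t‖ ^ 2 ≤ 2 * (‖x‖ ^ 2 + T * ∫ s in (0 : ℝ)..T, ‖β s.toNNReal‖ ^ 2) *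
      Real.exp (K * T) ^ 2 := by
  calc ‖f t‖ ^ 2
      ≤ ((‖x‖ + ∫ s in (0 : ℝ)..T, ‖β s.toNNReal‖) * Real.exp (K * T)) ^ 2 :=
        pow_le_pow_left₀ (norm_nonneg _) (hf.norm_le ha haK hβ ht) 2
    _ ≤ 2 * (‖x‖ ^ 2 + (∫ s in (0 : ℝ)..T, ‖β s.toNNReal‖) ^ 2) * Real.exp (K * T) ^ 2 := by
        rw [mul_pow]
        gcongr
        exact add_sq_le
    _ ≤ _ := by
        gcongr
        exact sq_intervalIntegral_le T.coe_nonneg (hβ T).norm (hβ₂ T)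

end IsSolutionPath

end SolutionPath

section Progressive

variable {Ω : Type*} {mΩ : MeasurableSpace Ω} {𝔽 : Filtration ℝ≥0 mΩ}

section MeasurableIic

variable {m : MeasurableSpace Ω} {S : Type*} [MeasurableSpace S]

theorem measurable_min_of_measurable_Iic {T : ℝ≥0} {u : ℝ≥0 → Ω → S}
    (hu : Measurable fun p : Set.Iic T × Ω => u p.1 p.2) :
    Measurable fun p : ℝ≥0 × Ω => u (min p.1 T) p.2 :=
  hu.comp (Measurable.prodMk ((measurable_fst.min measurable_const).subtype_mk
    (h := fun p => Set.mem_Iic.2 (min_le_right p.1 T))) measurable_snd)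

theorem measurable_integral_of_measurable_Iic {E : Type*} [NormedAddCommGroup E] [NormedSpace ℝ E]
    [MeasurableSpace E] [BorelSpace E] [SecondCountableTopology E] {T : ℝ≥0} {u : ℝ≥0 → Ω → E}
    (hu : Measurable fun p : Set.Iic T × Ω => u p.1 p.2) :
    Measurable fun p : Set.Iic T × Ω => ∫ s in (0 : ℝ)..(p.1 : ℝ≥0), u s.toNNReal p.2 := by
  have rescale (p : Set.Iic T × Ω) : ∫ s in (0 : ℝ)..(p.1 : ℝ≥0), u s.toNNReal p.2 =
      ((p.1 : ℝ≥0) : ℝ) • ∫ r in (0 : ℝ)..1, u (min (p.1 * r.toNNReal) T) p.2 := by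
    have substitution := intervalIntegral.smul_integral_comp_mul_left (a := 0) (b := 1)
      (fun s : ℝ => u s.toNNReal p.2) ((p.1 : ℝ≥0) : ℝ)
    rw [mul_zero, mul_one] at substitution
    rw [← substitution]
    congr 1
    refine intervalIntegral.integral_congr fun r hr => ?_
    rw [Set.uIcc_of_le zero_le_one] at hr
    have scaled_le : (p.1 : ℝ≥0) * r.toNNReal ≤ T :=
      (mul_le_of_le_one_right' (Real.toNNReal_le_one.2 hr.2)).trans p.1.2
    simp only [Real.toNNReal_mul (NNReal.coe_nonneg _), Real.toNNReal_coe, min_eq_left scaled_le]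
  have integrand_measurable : Measurable fun q : (Set.Iic T × Ω) × ℝ =>
      u (min (q.1.1 * q.2.toNNReal) T) q.1.2 :=
    (measurable_min_of_measurable_Iic hu).comp (Measurable.prodMk (by fun_prop) (by fun_prop))
  simp only [rescale, intervalIntegral.integral_of_le zero_le_one]
  exact Measurable.smul (by fun_prop)
    (integrand_measurable.stronglyMeasurable.integral_prod_right'
      (ν := volume.restrict _)).measurable

theorem tendsto_natFloor_mul_add_one_div (u : ℝ≥0) :
    Tendsto (fun N : ℕ => ((⌊u * (N + 1)⌋₊ + 1) / (N + 1) : ℝ≥0)) atTop (𝓝[>] u) := by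
  have gt_self (N : ℕ) : u < ((⌊u * (N + 1)⌋₊ + 1) / (N + 1) : ℝ≥0) := by
    rw [lt_div_iff₀ (by positivity)]
    exact Nat.lt_floor_add_one _
  have le_self_add (N : ℕ) : ((⌊u * (N + 1)⌋₊ + 1) / (N + 1) : ℝ≥0) ≤ u + 1 / (N + 1) := by
    rw [add_div]
    gcongr
    rw [div_le_iff₀ (by positivity)]
    exact Nat.floor_le zero_le
  refine tendsto_nhdsWithin_iff.2 ⟨?_, .of_forall gt_self⟩
  refine tendsto_of_tendsto_of_tendsto_of_le_of_le tendsto_const_nhds ?_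
    (fun N => (gt_self N).le) le_self_add
  simpa using (tendsto_one_div_add_atTop_nhds_zero_nat (𝕜 := ℝ≥0)).const_add u

theorem measurable_Iic_of_rightContinuous [TopologicalSpace S]
    [TopologicalSpace.PseudoMetrizableSpace S] [BorelSpace S] {T : ℝ≥0} {u : ℝ≥0 → Ω → S}
    (hu : ∀ t ≤ T, Measurable (u t))
    (hcont : ∀ ω t, ContinuousWithinAt (fun s => u s ω) (Set.Ioi t) t) :
    Measurable fun p : Set.Iic T × Ω => u p.1 p.2 := by
  let grid (N k : ℕ) : ℝ≥0 := min ((k + 1) / (N + 1)) T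
  refine measurable_of_tendsto_metrizable (f := fun (N : ℕ) (p : Set.Iic T × Ω) =>
    u (grid N ⌊(p.1 : ℝ≥0) * (N + 1)⌋₊) p.2) (fun N => ?_) (tendsto_pi_nhds.2 fun p => ?_)
  · have measurable_of_index : Measurable fun q : ℕ × Ω => u (grid N q.1) q.2 :=
      measurable_from_prod_countable_right fun k => hu (grid N k) (min_le_right _ _)
    have index_measurable : Measurable fun p : Set.Iic T × Ω =>
        (⌊(p.1 : ℝ≥0) * (N + 1)⌋₊, p.2) := by fun_prop
    simpa only [Function.comp_def] using measurable_of_index.comp index_measurable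
  · have grid_tendsto := tendsto_natFloor_mul_add_one_div (p.1 : ℝ≥0)
    have min_tendsto : Tendsto (fun N : ℕ => grid N ⌊(p.1 : ℝ≥0) * (N + 1)⌋₊) atTop
        (𝓝[≥] (p.1 : ℝ≥0)) := by
      refine tendsto_nhdsWithin_iff.2 ⟨?_, ?_⟩
      · have hmin := (grid_tendsto.mono_right nhdsWithin_le_nhds).min
          (tendsto_const_nhds (x := T))
        rwa [min_eq_left (Set.mem_Iic.1 p.1.2)] at hmin
      · exact (tendsto_nhdsWithin_iff.1 grid_tendsto).2.mono fun N hN =>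
          Set.mem_Ici.2 (le_min (Set.mem_Ioi.1 hN).le p.1.2)
    exact (continuousWithinAt_Ioi_iff_Ici.1 (hcont p.2 p.1)).tendsto.comp min_tendsto

end MeasurableIic

section General

variable {S : Type*} [MeasurableSpace S]

theorem isProgressive_of_rightContinuous [TopologicalSpace S]
    [TopologicalSpace.PseudoMetrizableSpace S] [BorelSpace S] {u : ℝ≥0 → Ω → S}
    (hu : ∀ t, Measurable[𝔽 t] (u t))
    (hcont : ∀ ω t, ContinuousWithinAt (fun s => u s ω) (Set.Ioi t) t) : IsProgressive 𝔽 u :=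
  fun T => measurable_Iic_of_rightContinuous (m := 𝔽 T)
    (fun t ht => (hu t).mono (𝔽.mono ht) le_rfl) hcont

theorem measurable_uncurry_of_isProgressive [TopologicalSpace S]
    [TopologicalSpace.PseudoMetrizableSpace S] [BorelSpace S] {u : ℝ≥0 → Ω → S}
    (hu : IsProgressive 𝔽 u) : Measurable fun p : ℝ≥0 × Ω => u p.1 p.2 := by
  refine measurable_of_tendsto_metrizable (f := fun (N : ℕ) (p : ℝ≥0 × Ω) => u (min p.1 N) p.2)
    (fun N => ?_) (tendsto_pi_nhds.2 fun p => ?_)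
  · exact measurable_min_of_measurable_Iic
      ((hu N).mono (sup_le_sup_left (MeasurableSpace.comap_mono (𝔽.le N)) _) le_rfl)
  · obtain ⟨N, hN⟩ := exists_nat_ge p.1
    refine tendsto_const_nhds.congr' ((eventually_ge_atTop N).mono fun k hk => ?_)
    simp only [min_eq_left (hN.trans (Nat.cast_le.2 hk))]

/-- Freezing the bad paths of `u` at time `0` keeps the process adapted, because the exceptional
null set already belongs to every `𝔽 t`. -/
theorem exists_isProgressive_ae_eq [TopologicalSpace S] [TopologicalSpace.PseudoMetrizableSpace S]
    [BorelSpace S] {P : Measure Ω}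
    (h𝔽 : ∀ N, MeasurableSet N → P N = 0 → MeasurableSet[𝔽 0] N) {u : ℝ≥0 → Ω → S}
    (hu : ∀ t, Measurable[𝔽 t] (u t))
    (hcont : ∀ᵐ ω ∂P, ∀ t, ContinuousWithinAt (fun s => u s ω) (Set.Ioi t) t) :
    ∃ v : ℝ≥0 → Ω → S, IsProgressive 𝔽 v ∧ ∀ᵐ ω ∂P, ∀ t, v t ω = u t ω := by
  classical
  set N := toMeasurable P {ω | ¬ ∀ t, ContinuousWithinAt (fun s => u s ω) (Set.Ioi t) t}
  have hPN : P N = 0 := (measure_toMeasurable _).trans hcont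
  have hN (t) : MeasurableSet[𝔽 t] N :=
    𝔽.mono zero_le _ (h𝔽 N (measurableSet_toMeasurable _ _) hPN)
  refine ⟨fun t => N.piecewise (u 0) (u t), isProgressive_of_rightContinuous (fun t => ?_) ?_, ?_⟩
  · exact Measurable.piecewise (hN t) ((hu 0).mono (𝔽.mono zero_le) le_rfl) (hu t)
  · intro ω t
    by_cases hω : ω ∈ N
    · simpa only [Set.piecewise_eq_of_mem _ _ _ hω] using continuousWithinAt_const
    · simp only [Set.piecewise_eq_of_notMem _ _ _ hω]
      exact not_not.1 (fun h => hω (subset_toMeasurable _ _ h)) t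
  · filter_upwards [measure_eq_zero_iff_ae_notMem.1 hPN] with ω hω t
    exact Set.piecewise_eq_of_notMem _ _ _ hω

end General

section VectorValued

theorem measurable_apply_coeff {ι : Type*} [Countable ι] [MeasurableSpace ι]
    [MeasurableSingletonClass ι] {E : Type*} [NormedAddCommGroup E] [NormedSpace ℝ E]
    [MeasurableSpace E] [BorelSpace E] (B : ι → E →L[ℝ] E) :
    Measurable fun q : ι × E => B q.1 q.2 :=
  measurable_from_prod_countable_right fun j => (B j).continuous.measurable

variable {E : Type*} [NormedAddCommGroup E] [MeasurableSpace E] [BorelSpace E]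
  [SecondCountableTopology E]

theorem isProgressive_tsum [CompleteSpace E] {u : ℕ → ℝ≥0 → Ω → E}
    (hu : ∀ k, IsProgressive 𝔽 (u k)) : IsProgressive 𝔽 fun t ω => ∑' k, u k t ω := fun T => by
  let _ : MeasurableSpace Ω := 𝔽 T
  exact (StronglyMeasurable.tsum fun k => (hu k T).stronglyMeasurable).measurable

variable [NormedSpace ℝ E]

theorem isProgressive_integral {u : ℝ≥0 → Ω → E} (hu : IsProgressive 𝔽 u) :
    IsProgressive 𝔽 fun t ω => ∫ s in (0 : ℝ)..t, u s.toNNReal ω :=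
  fun T => measurable_integral_of_measurable_Iic (m := 𝔽 T) (hu T)

variable {ι : Type*} [Countable ι] [MeasurableSpace ι] [MeasurableSingletonClass ι]

theorem isProgressive_iterate_volterra (B : ι → E →L[ℝ] E) {α : ℝ≥0 → Ω → ι}
    (hα : IsProgressive 𝔽 α) {y : ℝ≥0 → Ω → E} (hy : IsProgressive 𝔽 y) (k : ℕ) :
    IsProgressive 𝔽 fun t ω => (volterra fun s => B (α s ω))^[k] (fun s => y s ω) t := by
  induction k with
  | zero => exact hy
  | succ k ih =>
    simp only [Function.iterate_succ_apply']
    refine isProgressive_integral (u := fun s ω =>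
      B (α s ω) ((volterra fun s => B (α s ω))^[k] (fun s => y s ω) s)) fun T => ?_
    exact (measurable_apply_coeff B).comp (Measurable.prodMk (hα T) (ih T))

theorem isProgressive_picardSum [CompleteSpace E] (B : ι → E →L[ℝ] E) {α : ℝ≥0 → Ω → ι}
    (hα : IsProgressive 𝔽 α) {y : ℝ≥0 → Ω → E} (hy : IsProgressive 𝔽 y) :
    IsProgressive 𝔽 fun t ω => picardSum (fun s => B (α s ω)) (fun s => y s ω) t :=
  isProgressive_tsum fun k => isProgressive_iterate_volterra B hα hy k

end VectorValued

end Progressive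

section MatrixExponential

open Matrix

variable {ι : Type*} [Fintype ι] [DecidableEq ι]

theorem hasDerivAt_vecMul_exp_smul (c : ι → ℝ) (Q : Matrix ι ι ℝ) (k : ι) (t : ℝ) :
    HasDerivAt (fun t : ℝ => (c ᵥ* NormedSpace.exp (t • Q)) k)
      ((c ᵥ* NormedSpace.exp (t • Q) ᵥ* Q) k) t := by
  let _ : NormedRing (Matrix ι ι ℝ) := Matrix.linftyOpNormedRing
  let _ : NormedAlgebra ℝ (Matrix ι ι ℝ) := Matrix.linftyOpNormedAlgebra
  let evaluate : Matrix ι ι ℝ →ₗ[ℝ] ℝ := LinearMap.proj k ∘ₗ Matrix.vecMulBilin ℝ ℝ c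
  rw [vecMul_vecMul]
  exact evaluate.toContinuousLinearMap.hasFDerivAt.comp_hasDerivAt t (hasDerivAt_exp_smul_const Q t)

end MatrixExponential

section Fibers

variable {Ω : Type*} {mΩ : MeasurableSpace Ω} {P : Measure Ω} {ι : Type*}

theorem apply_eq_sum_indicator [Fintype ι] {G : Type*} [AddCommMonoid G] (a : Ω → ι)
    (g : ι → Ω → G) : (fun ω => g (a ω) ω) = fun ω => ∑ j, (a ⁻¹' {j}).indicator (g j) ω := by
  classical
  funext ω
  simp [Set.indicator_apply]

variable [MeasurableSpace ι] [MeasurableSingletonClass ι] {G : Type*} [NormedAddCommGroup G]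

theorem integrable_apply [Finite ι] {a : Ω → ι} (ha : Measurable a) {g : ι → Ω → G}
    (hg : ∀ j, Integrable (g j) P) : Integrable (fun ω => g (a ω) ω) P := by
  cases nonempty_fintype ι
  rw [apply_eq_sum_indicator]
  exact integrable_finsetSum _ fun j _ => (hg j).indicator (ha (measurableSet_singleton j))

theorem integral_apply_eq_sum_setIntegral [Fintype ι] [NormedSpace ℝ G] {a : Ω → ι}
    (ha : Measurable a) {g : ι → Ω → G} (hg : ∀ j, Integrable (g j) P) :
    ∫ ω, g (a ω) ω ∂P = ∑ j, ∫ ω in a ⁻¹' {j}, g j ω ∂P := by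
  have fiber_measurable (j : ι) : MeasurableSet (a ⁻¹' {j}) := ha (measurableSet_singleton j)
  simp only [apply_eq_sum_indicator, ← integral_indicator (fiber_measurable _)]
  exact integral_finsetSum _ fun j _ => (hg j).indicator (fiber_measurable j)

end Fibers

section Markov

open Matrix

variable {Ω : Type*} {mΩ : MeasurableSpace Ω} {P : Measure Ω} {𝔽 : Filtration ℝ≥0 mΩ}
  {ι : Type*} [Fintype ι] [DecidableEq ι] {Q : Matrix ι ι ℝ} {α : ℝ≥0 → Ω → ι}

/-- The Markov property of `α` with respect to `𝔽`, with the transition matrices `exp (t Q)`. -/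
def HasMarkovProperty (P : Measure Ω) (𝔽 : Filtration ℝ≥0 mΩ) (Q : Matrix ι ι ℝ)
    (α : ℝ≥0 → Ω → ι) : Prop :=
  ∀ s t : ℝ≥0, s ≤ t → ∀ j : ι,
    P[(α t ⁻¹' {j}).indicator (fun _ => (1 : ℝ)) | 𝔽 s] =ᵐ[P]
      fun ω => NormedSpace.exp (((t : ℝ) - (s : ℝ)) • Q) (α s ω) j

theorem HasMarkovProperty.congr {β : ℝ≥0 → Ω → ι} (hα : HasMarkovProperty P 𝔽 Q α)
    (h : ∀ᵐ ω ∂P, ∀ t, β t ω = α t ω) : HasMarkovProperty P 𝔽 Q β := by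
  intro s t hst j
  have indicator_eq : (β t ⁻¹' {j}).indicator (fun _ => (1 : ℝ)) =ᵐ[P]
      (α t ⁻¹' {j}).indicator fun _ => 1 := by
    filter_upwards [h] with ω hω
    simp only [Set.indicator, Set.mem_preimage, hω t]
  filter_upwards [condExp_congr_ae indicator_eq (m := 𝔽 s), hα s t hst j, h] with ω h₁ h₂ h₃
  rw [h₁, h₂, h₃ s]

namespace HasMarkovProperty

variable [MeasurableSpace ι] [MeasurableSingletonClass ι] [IsFiniteMeasure P] {s t : ℝ≥0}
  {W : Ω → ℝ}

theorem setIntegral_eq_vecMul_exp (hM : HasMarkovProperty P 𝔽 Q α) (hα : ∀ t, Measurable (α t))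
    (hW : StronglyMeasurable[𝔽 s] W) (hWi : Integrable W P) (hst : s ≤ t) (j : ι) :
    ∫ ω in α t ⁻¹' {j}, W ω ∂P =
      ((fun l => ∫ ω in α s ⁻¹' {l}, W ω ∂P) ᵥ* NormedSpace.exp (((t : ℝ) - s) • Q)) j := by
  have fiber_measurable : MeasurableSet (α t ⁻¹' {j}) := hα t (measurableSet_singleton j)
  have indicator_eq_mul :
      (α t ⁻¹' {j}).indicator W = (α t ⁻¹' {j}).indicator (fun _ => (1 : ℝ)) * W := by
    funext ω
    by_cases hω : ω ∈ α t ⁻¹' {j} <;> simp [hω]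
  have pull_out := condExp_mul_of_stronglyMeasurable_right hW
    (indicator_eq_mul ▸ hWi.indicator fiber_measurable)
    ((integrable_const (1 : ℝ)).indicator fiber_measurable)
  rw [← integral_indicator fiber_measurable, indicator_eq_mul, ← integral_condExp (𝔽.le s),
    integral_congr_ae (pull_out.trans ((hM s t hst j).mul .rfl))]
  refine (integral_apply_eq_sum_setIntegral (hα s) (g := fun l ω =>
    NormedSpace.exp (((t : ℝ) - s) • Q) l j * W ω) fun l => hWi.const_mul _).trans ?_
  simp only [integral_const_mul, vecMul, dotProduct]
  exact Finset.sum_congr rfl fun l _ => mul_comm _ _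

theorem continuousOn_setIntegral (hM : HasMarkovProperty P 𝔽 Q α) (hα : ∀ t, Measurable (α t))
    (hW : StronglyMeasurable[𝔽 s] W) (hWi : Integrable W P) (j : ι) :
    ContinuousOn (fun u : ℝ => ∫ ω in α u.toNNReal ⁻¹' {j}, W ω ∂P) (Set.Ici (s : ℝ)) := by
  have continuous_vecMul_exp : Continuous fun u : ℝ =>
      ((fun l => ∫ ω in α s ⁻¹' {l}, W ω ∂P) ᵥ* NormedSpace.exp ((u - s) • Q)) j :=
    (continuous_iff_continuousAt.2 fun r => (hasDerivAt_vecMul_exp_smul _ Q j r).continuousAt).comp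
      (continuous_id.sub continuous_const)
  refine continuous_vecMul_exp.continuousOn.congr fun u hu => ?_
  rw [hM.setIntegral_eq_vecMul_exp hα hW hWi (NNReal.le_toNNReal_of_coe_le hu),
    Real.coe_toNNReal u (s.coe_nonneg.trans hu)]

theorem kolmogorov_forward_equation (hM : HasMarkovProperty P 𝔽 Q α) (hα : ∀ t, Measurable (α t))
    (hW : StronglyMeasurable[𝔽 s] W) (hWi : Integrable W P) (hst : s ≤ t) (k : ι) :
    ∫ ω in α t ⁻¹' {k}, W ω ∂P - ∫ ω in α s ⁻¹' {k}, W ω ∂P =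
      ∫ u in (s : ℝ)..t, ((fun j => ∫ ω in α u.toNNReal ⁻¹' {j}, W ω ∂P) ᵥ* Q) k := by
  set mass : ℝ → ι → ℝ := fun u j => ∫ ω in α u.toNNReal ⁻¹' {j}, W ω ∂P
  have mass_eq (u : ℝ) (hu : (s : ℝ) ≤ u) : mass u = mass s ᵥ* NormedSpace.exp ((u - s) • Q) := by
    funext j
    simpa [mass, Real.coe_toNNReal u (s.coe_nonneg.trans hu)] using
      hM.setIntegral_eq_vecMul_exp hα hW hWi (NNReal.le_toNNReal_of_coe_le hu) j
  have hst' : (s : ℝ) ≤ t := hst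
  have forward (u : ℝ) (hu : u ∈ Set.uIcc (s : ℝ) t) :
      HasDerivAt (fun u : ℝ => (mass s ᵥ* NormedSpace.exp ((u - s) • Q)) k)
        ((mass u ᵥ* Q) k) u := by
    rw [Set.uIcc_of_le hst'] at hu
    rw [mass_eq u hu.1]
    exact (hasDerivAt_vecMul_exp_smul (mass s) Q k (u - s)).comp_sub_const u s
  have rate_continuousOn : ContinuousOn (fun u => (mass u ᵥ* Q) k) (Set.uIcc (s : ℝ) t) := by
    rw [Set.uIcc_of_le hst']
    exact continuousOn_finsetSum _ fun j _ => ((hM.continuousOn_setIntegral hα hW hWi j).mono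
      Set.Icc_subset_Ici_self).mul continuousOn_const
  have ftc := intervalIntegral.integral_eq_sub_of_hasDerivAt forward
    rate_continuousOn.intervalIntegrable
  simp only [← mass_eq t hst', ← mass_eq s le_rfl] at ftc
  simpa [mass] using ftc.symm

theorem dynkin_formula (hM : HasMarkovProperty P 𝔽 Q α)
    (hα : ∀ t, Measurable (α t)) {W : ι → Ω → ℝ} (hW : ∀ k, StronglyMeasurable[𝔽 s] (W k))
    (hWi : ∀ k, Integrable (W k) P) (hst : s ≤ t) :
    ∫ ω, W (α t ω) ω ∂P - ∫ ω, W (α s ω) ω ∂P =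
      ∫ u in (s : ℝ)..t, ∫ ω, ∑ k, Q (α u.toNNReal ω) k * W k ω ∂P := by
  have generator_eq (u : ℝ) : ∫ ω, ∑ k, Q (α u.toNNReal ω) k * W k ω ∂P =
      ∑ k, ((fun j => ∫ ω in α u.toNNReal ⁻¹' {j}, W k ω ∂P) ᵥ* Q) k := by
    rw [integral_apply_eq_sum_setIntegral (hα u.toNNReal) (g := fun j ω => ∑ k, Q j k * W k ω)
      fun j => integrable_finsetSum _ fun k _ => (hWi k).const_mul _]
    simp only [vecMul, dotProduct]
    rw [Finset.sum_comm]
    refine Finset.sum_congr rfl fun j _ => ?_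
    rw [integral_finsetSum _ fun k _ => ((hWi k).const_mul _).integrableOn]
    simp only [integral_const_mul, mul_comm]
  have rate_integrable (k : ι) : IntervalIntegrable (fun u : ℝ =>
      ((fun j => ∫ ω in α u.toNNReal ⁻¹' {j}, W k ω ∂P) ᵥ* Q) k) volume s t := by
    refine ContinuousOn.intervalIntegrable_of_Icc hst ?_
    exact continuousOn_finsetSum _ fun j _ =>
      ((hM.continuousOn_setIntegral hα (hW k) (hWi k) j).mono Set.Icc_subset_Ici_self).mul
        continuousOn_const
  simp only [generator_eq]
  rw [intervalIntegral.integral_finsetSum fun k _ => rate_integrable k,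
    integral_apply_eq_sum_setIntegral (hα t) hWi, integral_apply_eq_sum_setIntegral (hα s) hWi,
    ← Finset.sum_sub_distrib]
  exact Finset.sum_congr rfl fun k _ => hM.kolmogorov_forward_equation hα (hW k) (hWi k) hst k

end HasMarkovProperty

end Markov

section IntegrationByParts

variable {E F G : Type*} [NormedAddCommGroup E] [NormedSpace ℝ E] [NormedAddCommGroup F]
  [NormedSpace ℝ F] [NormedAddCommGroup G] [NormedSpace ℝ G] [CompleteSpace G]
  (L : E →L[ℝ] F →L[ℝ] G) {μ : Measure ℝ} {f : ℝ → E} {g : ℝ → F}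

theorem integral_indicator_le_bilin [CompleteSpace F] (hg : Integrable g μ) (u : ℝ) :
    ∫ v, {p : ℝ × ℝ | p.2 ≤ p.1}.indicator (fun p => L (f p.1) (g p.2)) (u, v) ∂μ =
      L (f u) (∫ v in Set.Iic u, g v ∂μ) := by
  rw [← ContinuousLinearMap.integral_comp_comm (L (f u)) hg.integrableOn,
    ← integral_indicator measurableSet_Iic]
  rfl

theorem integrable_bilin_integral_Iic [CompleteSpace F] [SFinite μ] (hf : Integrable f μ)
    (hg : Integrable g μ) :
    Integrable (fun u => L (f u) (∫ v in Set.Iic u, g v ∂μ)) μ := by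
  simp only [← integral_indicator_le_bilin L hg]
  exact ((hf.op_fst_snd (op := fun a b => L a b) (by fun_prop) ⟨‖L‖, L.le_opNorm₂⟩ hg).indicator
    (measurableSet_le measurable_snd measurable_fst)).integral_prod_left

theorem integral_Iic_restrict_Ioc {T u : ℝ} (hu : u ∈ Set.Ioc 0 T) :
    ∫ v in Set.Iic u, f v ∂(volume.restrict (Set.Ioc 0 T)) = ∫ v in (0 : ℝ)..u, f v := by
  rw [Measure.restrict_restrict measurableSet_Iic, Set.Iic_inter_Ioc_of_le hu.2,
    intervalIntegral.integral_of_le hu.1.le]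

variable [CompleteSpace E] [CompleteSpace F]

theorem bilin_integral_integral [SFinite μ] [NullSingletonClass μ] (hf : Integrable f μ)
    (hg : Integrable g μ) :
    L (∫ u, f u ∂μ) (∫ u, g u ∂μ) = ∫ u, L (f u) (∫ v in Set.Iic u, g v ∂μ) ∂μ +
      ∫ u, L (∫ v in Set.Iic u, f v ∂μ) (g u) ∂μ := by
  let triangle : Set (ℝ × ℝ) := {p | p.2 ≤ p.1}
  have triangle_measurable : MeasurableSet triangle :=
    measurableSet_le measurable_snd measurable_fst
  have product_integrable : Integrable (fun p : ℝ × ℝ => L (f p.1) (g p.2)) (μ.prod μ) :=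
    hf.op_fst_snd (by fun_prop) ⟨‖L‖, L.le_opNorm₂⟩ hg
  have slice_compl (v : ℝ) : ∫ u, triangleᶜ.indicator (fun p => L (f p.1) (g p.2)) (u, v) ∂μ =
      L (∫ u in Set.Iic v, f u ∂μ) (g v) := by
    rw [← ContinuousLinearMap.flip_apply, integral_Iic_eq_integral_Iio,
      ← ContinuousLinearMap.integral_comp_comm (L.flip (g v)) hf.integrableOn,
      ← integral_indicator measurableSet_Iio]
    exact integral_congr_ae (ae_of_all _ fun u => by simp [triangle, Set.indicator_apply])
  rw [← integral_prod_bilin L hf hg, ← integral_add_compl triangle_measurable product_integrable,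
    ← integral_indicator triangle_measurable, ← integral_indicator triangle_measurable.compl,
    integral_prod _ (product_integrable.indicator triangle_measurable),
    integral_prod_symm _ (product_integrable.indicator triangle_measurable.compl)]
  simp only [triangle, slice_compl, integral_indicator_le_bilin L hg]

theorem bilin_add_integral_sub_bilin {T : ℝ} (hT : 0 ≤ T) (hf : IntervalIntegrable f volume 0 T)
    (hg : IntervalIntegrable g volume 0 T) (x : E) (y : F) :
    L (x + ∫ u in (0 : ℝ)..T, f u) (y + ∫ u in (0 : ℝ)..T, g u) - L x y =
      ∫ u in (0 : ℝ)..T, (L (f u) (y + ∫ v in (0 : ℝ)..u, g v) +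
        L (x + ∫ v in (0 : ℝ)..u, f v) (g u)) := by
  simp only [intervalIntegral.integral_of_le hT]
  rw [intervalIntegrable_iff_integrableOn_Ioc_of_le hT] at hf hg
  have integrand_eq : ∀ u ∈ Set.Ioc 0 T, L (f u) (y + ∫ v in (0 : ℝ)..u, g v) +
      L (x + ∫ v in (0 : ℝ)..u, f v) (g u) = L.flip y (f u) + L x (g u) +
        (L (f u) (∫ v in Set.Iic u, g v ∂(volume.restrict (Set.Ioc 0 T))) +
          L.flip (g u) (∫ v in Set.Iic u, f v ∂(volume.restrict (Set.Ioc 0 T)))) := by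
    intro u hu
    rw [integral_Iic_restrict_Ioc hu, integral_Iic_restrict_Ioc hu]
    simp only [map_add, add_apply, ContinuousLinearMap.flip_apply]
    abel
  have first_integrable := integrable_bilin_integral_Iic L hf hg
  have second_integrable := integrable_bilin_integral_Iic L.flip hg hf
  have boundary_integrable : Integrable (fun u => L.flip y (f u) + L x (g u))
      (volume.restrict (Set.Ioc 0 T)) :=
    ((L.flip y).integrable_comp hf).add ((L x).integrable_comp hg)
  rw [setIntegral_congr_fun measurableSet_Ioc integrand_eq,
    integral_add boundary_integrable ?_,
    integral_add ((L.flip y).integrable_comp hf) ((L x).integrable_comp hg),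
    integral_add first_integrable second_integrable, ContinuousLinearMap.integral_comp_comm _ hf,
    ContinuousLinearMap.integral_comp_comm _ hg]
  · simp only [ContinuousLinearMap.flip_apply, ← bilin_integral_integral L hf hg, map_add,
      add_apply]
    abel
  · exact first_integrable.add second_integrable

end IntegrationByParts

section EntryIntegral

variable {ι : Type*} [Finite ι] [MeasurableSpace ι] [MeasurableSingletonClass ι] {Q : Matrix ι ι ℝ}
  {a : ℝ≥0 → ι}

theorem intervalIntegrable_entry (ha : Measurable a) (k : ι) (s t : ℝ) :
    IntervalIntegrable (fun u : ℝ => Q (a u.toNNReal) k) volume s t := by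
  obtain ⟨K, hK⟩ := Finite.exists_le fun j => ‖Q j k‖
  exact (intervalIntegrable_const (c := K)).mono_fun
    ((measurable_of_countable (Q · k)).comp
      (ha.comp measurable_real_toNNReal)).aestronglyMeasurable
    (ae_of_all _ fun _ => (hK _).trans (le_abs_self _))

theorem continuous_integral_entry (ha : Measurable a) (k : ι) (T : ℝ) :
    Continuous fun s : ℝ => ∫ u in s..T, Q (a u.toNNReal) k := by
  rw [funext fun s => intervalIntegral.integral_symm T s]
  exact (intervalIntegral.continuous_primitive (intervalIntegrable_entry ha k) T).neg

theorem intervalIntegrable_entry_mul (ha : Measurable a) {Φ : ℝ≥0 → ℝ} (hΦ : Continuous Φ) (k : ι)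
    (s t : ℝ) : IntervalIntegrable (fun u : ℝ => Q (a u.toNNReal) k * Φ u.toNNReal) volume s t :=
  (intervalIntegrable_entry ha k s t).mul_continuousOn
    (hΦ.comp continuous_real_toNNReal).continuousOn

theorem intervalIntegrable_integral_entry_mul (ha : Measurable a) {φ : ℝ → ℝ} {s t : ℝ}
    (hφ : IntervalIntegrable φ volume s t) (k : ι) (T : ℝ) :
    IntervalIntegrable (fun u => (∫ v in u..T, Q (a v.toNNReal) k) * φ u) volume s t :=
  hφ.continuousOn_mul (continuous_integral_entry ha k T).continuousOn

theorem integral_entry_mul {Φ φ : ℝ≥0 → ℝ} (ha : Measurable a)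
    (hφ : ∀ t : ℝ≥0, IntervalIntegrable (fun u : ℝ => φ u.toNNReal) volume 0 t)
    (hΦ : ∀ t : ℝ≥0, Φ t = Φ 0 + ∫ u in (0 : ℝ)..t, φ u.toNNReal) (k : ι) (T : ℝ≥0) :
    ∫ u in (0 : ℝ)..T, Q (a u.toNNReal) k * Φ u.toNNReal =
      (∫ u in (0 : ℝ)..T, Q (a u.toNNReal) k) * Φ 0 +
        ∫ u in (0 : ℝ)..T, (∫ v in u..T, Q (a v.toNNReal) k) * φ u.toNNReal := by
  have hq := intervalIntegrable_entry (Q := Q) ha k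
  have remaining_eq (u : ℝ) : (∫ v in (0 : ℝ)..T, Q (a v.toNNReal) k) +
      ∫ v in (0 : ℝ)..u, -Q (a v.toNNReal) k = ∫ v in u..T, Q (a v.toNNReal) k := by
    rw [intervalIntegral.integral_neg, ← sub_eq_add_neg,
      intervalIntegral.integral_interval_sub_left (hq 0 T) (hq 0 u)]
  have parts := bilin_add_integral_sub_bilin (ContinuousLinearMap.mul ℝ ℝ) T.coe_nonneg
    (hq 0 T).neg (hφ T) (∫ v in (0 : ℝ)..T, Q (a v.toNNReal) k) (Φ 0)
  simp only [ContinuousLinearMap.mul_apply', Pi.neg_apply, remaining_eq,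
    intervalIntegral.integral_same, zero_mul, zero_sub] at parts
  have integrand_eq : ∀ u ∈ Set.uIcc (0 : ℝ) T, -Q (a u.toNNReal) k * (Φ 0 +
      ∫ v in (0 : ℝ)..u, φ v.toNNReal) + (∫ v in u..T, Q (a v.toNNReal) k) * φ u.toNNReal =
      (∫ v in u..T, Q (a v.toNNReal) k) * φ u.toNNReal - Q (a u.toNNReal) k * Φ u.toNNReal := by
    intro u hu
    rw [Set.uIcc_of_le T.coe_nonneg] at hu
    rw [hΦ u.toNNReal, Real.coe_toNNReal u hu.1]
    ring
  rw [intervalIntegral.integral_congr integrand_eq, intervalIntegral.integral_sub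
    (intervalIntegrable_integral_entry_mul ha (hφ T) k T)
    (intervalIntegrable_entry_mul ha (continuous_of_eq_add_integral hφ hΦ) k 0 T)] at parts
  linarith

theorem intervalIntegrable_apply {φ : ι → ℝ≥0 → ℝ} (ha : Measurable a)
    (hφ : ∀ k, ∀ t : ℝ≥0, IntervalIntegrable (fun u : ℝ => φ k u.toNNReal) volume 0 t) (T : ℝ≥0) :
    IntervalIntegrable (fun u : ℝ => φ (a u.toNNReal) u.toNNReal) volume 0 T := by
  simp only [intervalIntegrable_iff] at hφ ⊢
  exact integrable_apply (ha.comp measurable_real_toNNReal) fun k => hφ k T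

theorem measurable_integral_entry {Ω : Type*} {mΩ : MeasurableSpace Ω} {α : ℝ≥0 → Ω → ι}
    (hα : Measurable fun p : ℝ≥0 × Ω => α p.1 p.2) (k : ι) (T : ℝ) :
    Measurable fun p : ℝ × Ω => ∫ u in p.1..T, Q (α u.toNNReal p.2) k := by
  have entry_measurable : StronglyMeasurable fun p : ℝ × Ω => Q (α p.1.toNNReal p.2) k :=
    ((measurable_of_countable (Q · k)).comp (hα.comp
      (measurable_real_toNNReal.prodMap measurable_id))).stronglyMeasurable
  refine measurable_uncurry_of_continuous_of_measurable
    (u := fun s ω => ∫ u in s..T, Q (α u.toNNReal ω) k)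
    (fun ω => continuous_integral_entry (hα.comp measurable_prodMk_right) k T) fun s => ?_
  exact (entry_measurable.integral_prod_left'.sub entry_measurable.integral_prod_left').measurable

end EntryIntegral

section DynkinIncrement

variable {ι : Type*} [Fintype ι] {Q : Matrix ι ι ℝ} {a : ℝ≥0 → ι}

/-- The increment over `[s, t]`, along the path `a` of a Markov chain with generator `Q`, of the
Dynkin martingale `w (a t) - ∫₀ᵗ (Q w) (a u) du` of a function `w` of the state. -/
def dynkinIncrement (Q : Matrix ι ι ℝ) (a : ℝ≥0 → ι) (s t : ℝ) (w : ι → ℝ) : ℝ :=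
  w (a t.toNNReal) - w (a s.toNNReal) - ∑ k, (∫ u in s..t, Q (a u.toNNReal) k) * w k

/-- The stochastic integral over `[0, T]`, against the Dynkin martingales, of coefficients with
initial value `w` and time derivative `φ`. It is encoded through integration by parts: the
coefficient `φ u` is switched on at time `u`, so that no martingale integral has to be defined. -/
def dynkinIntegral (Q : Matrix ι ι ℝ) (a : ℝ≥0 → ι) (T : ℝ≥0) (w : ι → ℝ) (φ : ι → ℝ≥0 → ℝ) : ℝ :=
  dynkinIncrement Q a 0 T w + ∫ u in (0 : ℝ)..T, dynkinIncrement Q a u T (φ · u.toNNReal)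

theorem norm_entry_le (Q : Matrix ι ι ℝ) (j k : ι) : ‖Q j k‖ ≤ ∑ i, ‖Q i k‖ :=
  Finset.single_le_sum (f := fun i => ‖Q i k‖) (fun _ _ => norm_nonneg _) (Finset.mem_univ j)

theorem norm_integral_entry_le {s T : ℝ} (hs : s ∈ Set.Icc 0 T) (k : ι) :
    ‖∫ u in s..T, Q (a u.toNNReal) k‖ ≤ (∑ i, ‖Q i k‖) * T := by
  refine (intervalIntegral.norm_integral_le_of_norm_le_const fun u _ =>
    norm_entry_le Q _ k).trans ?_
  rw [abs_of_nonneg (sub_nonneg.2 hs.2)]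
  gcongr
  linarith [hs.1]

variable [MeasurableSpace ι] [MeasurableSingletonClass ι]

theorem intervalIntegrable_sum_entry_mul {Φ : ι → ℝ≥0 → ℝ} (ha : Measurable a)
    (hΦ : ∀ k, Continuous (Φ k)) (s t : ℝ) :
    IntervalIntegrable (fun u : ℝ => ∑ k, Q (a u.toNNReal) k * Φ k u.toNNReal) volume s t := by
  simpa only [Finset.sum_fn] using IntervalIntegrable.sum Finset.univ fun k _ =>
    intervalIntegrable_entry_mul (Q := Q) ha (hΦ k) k s t

theorem apply_sub_apply_sub_integral_eq {Φ φ : ι → ℝ≥0 → ℝ} (ha : Measurable a)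
    (hφ : ∀ k, ∀ t : ℝ≥0, IntervalIntegrable (fun u : ℝ => φ k u.toNNReal) volume 0 t)
    (hΦ : ∀ k, ∀ t : ℝ≥0, Φ k t = Φ k 0 + ∫ u in (0 : ℝ)..t, φ k u.toNNReal) (T : ℝ≥0) :
    Φ (a T) T - Φ (a 0) 0 - ∫ u in (0 : ℝ)..T, (φ (a u.toNNReal) u.toNNReal +
        ∑ k, Q (a u.toNNReal) k * Φ k u.toNNReal) =
      dynkinIntegral Q a T (Φ · 0) φ := by
  have current_integrable := intervalIntegrable_apply ha hφ T
  have entry_mul_integrable (k : ι) := intervalIntegrable_entry_mul (Q := Q) ha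
    (continuous_of_eq_add_integral (hφ k) (hΦ k)) k 0 T
  have remaining_mul_integrable (k : ι) :=
    intervalIntegrable_integral_entry_mul (Q := Q) ha (hφ k T) k T
  have entry_sum_integrable := intervalIntegrable_sum_entry_mul (Q := Q) ha
    (fun k => continuous_of_eq_add_integral (hφ k) (hΦ k)) 0 T
  have remaining_sum_integrable :=
    IntervalIntegrable.sum Finset.univ fun k _ => remaining_mul_integrable k
  simp only [Finset.sum_fn] at remaining_sum_integrable
  simp only [dynkinIntegral, dynkinIncrement]
  rw [intervalIntegral.integral_add current_integrable entry_sum_integrable,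
    intervalIntegral.integral_sub ((hφ _ T).sub current_integrable) remaining_sum_integrable,
    intervalIntegral.integral_sub (hφ _ T) current_integrable,
    intervalIntegral.integral_finsetSum fun k _ => entry_mul_integrable k,
    intervalIntegral.integral_finsetSum fun k _ => remaining_mul_integrable k]
  simp only [integral_entry_mul ha (hφ _) (hΦ _), Finset.sum_add_distrib, hΦ (a T) T,
    Real.toNNReal_coe, Real.toNNReal_zero]
  ring

end DynkinIncrement

section DynkinMartingale

variable {Ω : Type*} {mΩ : MeasurableSpace Ω} {P : Measure Ω} {ι : Type*} [Fintype ι]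
  [MeasurableSpace ι] [MeasurableSingletonClass ι] {Q : Matrix ι ι ℝ} {α : ℝ≥0 → Ω → ι}

theorem integrable_dynkinIncrement (hα : Measurable fun p : ℝ≥0 × Ω => α p.1 p.2) {Y : Type*}
    {mY : MeasurableSpace Y} {ν : Measure Y} {σ : Y → ℝ} {o : Y → Ω} (hσ : Measurable σ)
    (ho : Measurable o) {T : ℝ} (hσT : ∀ᵐ y ∂ν, σ y ∈ Set.Icc 0 T) {w : ι → Y → ℝ}
    (hw : ∀ k, Integrable (w k) ν) :
    Integrable (fun y => dynkinIncrement Q (α · (o y)) (σ y) T (w · y)) ν := by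
  have state_measurable (τ : Y → ℝ≥0) (hτ : Measurable τ) : Measurable fun y => α (τ y) (o y) :=
    hα.comp (hτ.prodMk ho)
  refine ((integrable_apply (state_measurable _ measurable_const) hw).sub
    (integrable_apply (state_measurable _ hσ.real_toNNReal) hw)).sub
      (integrable_finsetSum _ fun k _ => (hw k).bdd_mul (c := (∑ i, ‖Q i k‖) * T) ?_ ?_)
  · exact ((measurable_integral_entry hα k T).comp (hσ.prodMk ho)).aestronglyMeasurable
  · filter_upwards [hσT] with y hy
    exact norm_integral_entry_le (a := (α · (o y))) hy k

theorem integrable_dynkinIncrement_prod (hα : Measurable fun p : ℝ≥0 × Ω => α p.1 p.2) {T : ℝ≥0}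
    {φ : ι → ℝ≥0 → Ω → ℝ} (hφ : ∀ k, Integrable (fun p : ℝ × Ω => φ k p.1.toNNReal p.2)
      ((volume.restrict (Set.Ioc 0 (T : ℝ))).prod P)) :
    Integrable (fun p : ℝ × Ω => dynkinIncrement Q (α · p.2) p.1 T (φ · p.1.toNNReal p.2))
      ((volume.restrict (Set.Ioc 0 (T : ℝ))).prod P) := by
  have time_mem : ∀ᵐ u ∂volume.restrict (Set.Ioc 0 (T : ℝ)), u ∈ Set.Icc 0 (T : ℝ) :=
    (ae_restrict_mem measurableSet_Ioc).mono fun _ hu => Set.Ioc_subset_Icc_self hu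
  exact integrable_dynkinIncrement hα measurable_fst measurable_snd
    (Measure.quasiMeasurePreserving_fst.ae time_mem) hφ

theorem integrable_dynkinIncrement_zero (hα : Measurable fun p : ℝ≥0 × Ω => α p.1 p.2) (T : ℝ≥0)
    {W : ι → Ω → ℝ} (hW : ∀ k, Integrable (W k) P) :
    Integrable (fun ω => dynkinIncrement Q (α · ω) 0 T (W · ω)) P :=
  integrable_dynkinIncrement hα measurable_const measurable_id
    (ae_of_all _ fun _ => ⟨le_rfl, T.coe_nonneg⟩) hW

theorem integrable_integral_dynkinIncrement [SFinite P]
    (hα : Measurable fun p : ℝ≥0 × Ω => α p.1 p.2) {T : ℝ≥0} {φ : ι → ℝ≥0 → Ω → ℝ}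
    (hφ : ∀ k, Integrable (fun p : ℝ × Ω => φ k p.1.toNNReal p.2)
      ((volume.restrict (Set.Ioc 0 (T : ℝ))).prod P)) :
    Integrable (fun ω => ∫ u in (0 : ℝ)..T, dynkinIncrement Q (α · ω) u T (φ · u.toNNReal ω))
      P := by
  simp only [intervalIntegral.integral_of_le T.coe_nonneg]
  exact (integrable_dynkinIncrement_prod hα hφ).integral_prod_right

theorem integrable_dynkinIntegral [SFinite P] (hα : Measurable fun p : ℝ≥0 × Ω => α p.1 p.2)
    {T : ℝ≥0} {W : ι → Ω → ℝ} (hW : ∀ k, Integrable (W k) P) {φ : ι → ℝ≥0 → Ω → ℝ}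
    (hφ : ∀ k, Integrable (fun p : ℝ × Ω => φ k p.1.toNNReal p.2)
      ((volume.restrict (Set.Ioc 0 (T : ℝ))).prod P)) :
    Integrable (fun ω => dynkinIntegral Q (α · ω) T (W · ω) (φ · · ω)) P :=
  (integrable_dynkinIncrement_zero hα T hW).add (integrable_integral_dynkinIncrement hα hφ)

variable [IsFiniteMeasure P] [DecidableEq ι] {𝔽 : Filtration ℝ≥0 mΩ}

namespace HasMarkovProperty

theorem integral_dynkinIncrement (hM : HasMarkovProperty P 𝔽 Q α)
    (hα : Measurable fun p : ℝ≥0 × Ω => α p.1 p.2) {s T : ℝ≥0} (hsT : s ≤ T) {W : ι → Ω → ℝ}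
    (hW : ∀ k, StronglyMeasurable[𝔽 s] (W k)) (hWi : ∀ k, Integrable (W k) P) :
    ∫ ω, dynkinIncrement Q (α · ω) s T (W · ω) ∂P = 0 := by
  let μ := volume.restrict (Set.uIoc (s : ℝ) T)
  have : IsFiniteMeasure μ := ⟨by simp [μ]⟩
  have state_measurable (t : ℝ≥0) : Measurable (α t) := hα.comp measurable_prodMk_left
  have rate_integrable (k : ι) :
      Integrable (fun p : ℝ × Ω => Q (α p.1.toNNReal p.2) k * W k p.2) (μ.prod P) :=
    ((hWi k).comp_snd μ).bdd_mul (c := ∑ i, ‖Q i k‖)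
      ((measurable_of_countable (Q · k)).comp (hα.comp
        (measurable_real_toNNReal.prodMap measurable_id))).aestronglyMeasurable
      (ae_of_all _ fun p => norm_entry_le Q _ k)
  have rate_integral (ω : Ω) : ∑ k, (∫ u in (s : ℝ)..T, Q (α u.toNNReal ω) k) * W k ω =
      ∫ u in (s : ℝ)..T, ∑ k, Q (α u.toNNReal ω) k * W k ω := by
    simp only [← intervalIntegral.integral_mul_const]
    exact (intervalIntegral.integral_finsetSum fun k _ => (intervalIntegrable_entry
      (hα.comp measurable_prodMk_right) k _ _).mul_const _).symm
  have rate_sum_integrable : Integrable (fun ω => ∫ u in (s : ℝ)..T,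
      ∑ k, Q (α u.toNNReal ω) k * W k ω) P := by
    simp only [intervalIntegral.integral_of_le (NNReal.coe_le_coe.2 hsT),
      ← Set.uIoc_of_le (NNReal.coe_le_coe.2 hsT)]
    exact (integrable_finsetSum _ fun k _ => rate_integrable k).integral_prod_right
  simp only [dynkinIncrement, rate_integral, Real.toNNReal_coe]
  have end_integrable := integrable_apply (state_measurable T) hWi
  have start_integrable := integrable_apply (state_measurable s) hWi
  rw [integral_sub ?_ rate_sum_integrable,
    integral_sub end_integrable start_integrable,
    hM.dynkin_formula state_measurable hW hWi hsT,
    ← intervalIntegral_integral_swap (integrable_finsetSum _ fun k _ => rate_integrable k),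
    sub_self]
  exact end_integrable.sub start_integrable

theorem integral_integral_dynkinIncrement (hM : HasMarkovProperty P 𝔽 Q α)
    (hα : Measurable fun p : ℝ≥0 × Ω => α p.1 p.2) {T : ℝ≥0} {φ : ι → ℝ≥0 → Ω → ℝ}
    (hφ : ∀ k t, StronglyMeasurable[𝔽 t] (φ k t))
    (hφi : ∀ k, Integrable (fun p : ℝ × Ω => φ k p.1.toNNReal p.2)
      ((volume.restrict (Set.Ioc 0 (T : ℝ))).prod P)) :
    ∫ ω, (∫ u in (0 : ℝ)..T, dynkinIncrement Q (α · ω) u T (φ · u.toNNReal ω)) ∂P = 0 := by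
  have increment_integrable := integrable_dynkinIncrement_prod (Q := Q) hα hφi
  have slice_integrable : ∀ᵐ u ∂volume.restrict (Set.Ioc 0 (T : ℝ)),
      ∀ k, Integrable (φ k u.toNNReal) P :=
    ae_all_iff.2 fun k => (hφi k).prod_right_ae
  rw [← Set.uIoc_of_le T.coe_nonneg] at increment_integrable
  rw [← intervalIntegral_integral_swap increment_integrable,
    intervalIntegral.integral_of_le T.coe_nonneg]
  refine integral_eq_zero_of_ae ?_
  filter_upwards [slice_integrable, ae_restrict_mem measurableSet_Ioc] with u hu hu_mem
  have zero_mean := hM.integral_dynkinIncrement hα (Real.toNNReal_le_iff_le_coe.2 hu_mem.2)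
    (fun k => hφ k u.toNNReal) hu
  rwa [Real.coe_toNNReal u hu_mem.1.le] at zero_mean

theorem integral_dynkinIntegral (hM : HasMarkovProperty P 𝔽 Q α)
    (hα : Measurable fun p : ℝ≥0 × Ω => α p.1 p.2) {T : ℝ≥0} {W : ι → Ω → ℝ}
    (hW : ∀ k, StronglyMeasurable[𝔽 0] (W k)) (hWi : ∀ k, Integrable (W k) P)
    {φ : ι → ℝ≥0 → Ω → ℝ} (hφ : ∀ k t, StronglyMeasurable[𝔽 t] (φ k t))
    (hφi : ∀ k, Integrable (fun p : ℝ × Ω => φ k p.1.toNNReal p.2)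
      ((volume.restrict (Set.Ioc 0 (T : ℝ))).prod P)) :
    ∫ ω, dynkinIntegral Q (α · ω) T (W · ω) (φ · · ω) ∂P = 0 := by
  have initial_mean := hM.integral_dynkinIncrement hα (zero_le (a := T)) hW hWi
  rw [NNReal.coe_zero] at initial_mean
  simp only [dynkinIntegral]
  rw [integral_add (integrable_dynkinIncrement_zero hα T hWi)
    (integrable_integral_dynkinIncrement hα hφi), initial_mean,
    hM.integral_integral_dynkinIncrement hα hφ hφi, add_zero]

end HasMarkovProperty

end DynkinMartingale

section QuadraticForm

open scoped RealInnerProductSpace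

variable {E : Type*} [NormedAddCommGroup E] [InnerProductSpace ℝ E]

theorem intervalIntegrable_inner {f g : ℝ → E} {s t : ℝ} (hf : Continuous f)
    (hg : IntervalIntegrable g volume s t) :
    IntervalIntegrable (fun u => ⟪f u, g u⟫) volume s t := by
  obtain ⟨C, hC⟩ := isCompact_uIcc.exists_bound_of_continuousOn (s := Set.uIcc s t) hf.continuousOn
  refine (hg.norm.const_mul C).mono_fun'
    (hf.aestronglyMeasurable.inner hg.aestronglyMeasurable_restrict_uIoc) ?_
  filter_upwards [ae_restrict_mem measurableSet_uIoc] with u hu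
  exact (norm_inner_le_norm _ _).trans
    (mul_le_mul_of_nonneg_right (hC u (Set.uIoc_subset_uIcc hu)) (norm_nonneg _))

namespace IsSolutionPath

variable {a : ℝ≥0 → E →L[ℝ] E} {β : ℝ≥0 → E} {x : E} {f : ℝ≥0 → E}

theorem intervalIntegrable_two_mul_inner (hf : IsSolutionPath a β x f) (S : E →L[ℝ] E)
    (s t : ℝ) : IntervalIntegrable (fun u : ℝ => 2 * ⟪S (f u.toNNReal),
      a u.toNNReal (f u.toNNReal) + β u.toNNReal⟫) volume s t :=
  (intervalIntegrable_inner (S.continuous.comp (hf.continuous.comp continuous_real_toNNReal))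
    (hf.intervalIntegrable s t)).const_mul 2

theorem inner_apply_self_eq [CompleteSpace E] (hf : IsSolutionPath a β x f) {S : E →L[ℝ] E}
    (hS : S.IsSymmetric) (T : ℝ≥0) :
    ⟪S (f T), f T⟫ = ⟪S (f 0), f 0⟫ + ∫ u in (0 : ℝ)..T,
      2 * ⟪S (f u.toNNReal), a u.toNNReal (f u.toNNReal) + β u.toNNReal⟫ := by
  have inner_comm (y z : E) : ⟪S y, z⟫ = ⟪S z, y⟫ := (hS y z).trans (real_inner_comm _ _)
  have parts := bilin_add_integral_sub_bilin
    ((isBoundedBilinearMap_inner (𝕜 := ℝ) (E := E)).toContinuousLinearMap ∘L S) T.coe_nonneg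
    (hf T).1 (hf T).1 x x
  simp only [ContinuousLinearMap.comp_apply,
    IsBoundedBilinearMap.toContinuousLinearMap_apply, ← (hf T).2] at parts
  rw [hf.apply_zero, ← sub_eq_iff_eq_add', parts]
  refine intervalIntegral.integral_congr fun u hu => ?_
  rw [Set.uIcc_of_le T.coe_nonneg] at hu
  have path_eq := (hf u.toNNReal).2
  rw [Real.coe_toNNReal u hu.1] at path_eq
  simp only [← path_eq, inner_comm (a u.toNNReal (f u.toNNReal) + β u.toNNReal), two_mul]

end IsSolutionPath

end QuadraticForm

section Lyapunov

open scoped RealInnerProductSpace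

variable {ι : Type*} [Fintype ι] {E : Type*} [NormedAddCommGroup E] [InnerProductSpace ℝ E]

/-- The mode-dependent quadratic forms `v ↦ ⟪V j v, v⟫` form a Lyapunov function with decay rate
`δ` for the switched system `ẋ = B(α) x`, where `α` is a Markov chain with generator `Q`. -/
structure IsLyapunov (Q : Matrix ι ι ℝ) (B V : ι → E →L[ℝ] E) (δ : ℝ) : Prop where
  pos : 0 < δ
  isPositive : ∀ j, (V j).IsPositive
  dissipative : ∀ j v, 2 * ⟪V j v, B j v⟫ + ∑ k, Q j k * ⟪V k v, v⟫ ≤ -δ * ‖v‖ ^ 2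

namespace IsLyapunov

variable {Q : Matrix ι ι ℝ} {B V : ι → E →L[ℝ] E} {δ κ : ℝ}

theorem drift_le (hV : IsLyapunov Q B V δ) (hκ : ∀ j, ‖V j‖ ≤ κ) (j : ι) (v β : E) :
    2 * ⟪V j v, B j v + β⟫ + ∑ k, Q j k * ⟪V k v, v⟫ ≤
      2 * κ ^ 2 / δ * ‖β‖ ^ 2 - δ / 2 * ‖v‖ ^ 2 := by
  have hδ := hV.pos
  have cross_le : ⟪V j v, β⟫ ≤ κ * ‖v‖ * ‖β‖ :=
    (real_inner_le_norm _ _).trans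
      (mul_le_mul_of_nonneg_right ((V j).le_of_opNorm_le (hκ j) v) (norm_nonneg _))
  have young : 2 * (κ * ‖v‖ * ‖β‖) ≤ 2 * κ ^ 2 / δ * ‖β‖ ^ 2 + δ / 2 * ‖v‖ ^ 2 := by
    have := two_mul_le_add_sq (2 * κ / δ * ‖β‖) ‖v‖
    calc 2 * (κ * ‖v‖ * ‖β‖) = δ / 2 * (2 * (2 * κ / δ * ‖β‖) * ‖v‖) := by field_simp
      _ ≤ δ / 2 * ((2 * κ / δ * ‖β‖) ^ 2 + ‖v‖ ^ 2) := by gcongr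
      _ = 2 * κ ^ 2 / δ * ‖β‖ ^ 2 + δ / 2 * ‖v‖ ^ 2 := by field_simp
  rw [inner_add_right]
  linarith [hV.dissipative j v]

theorem energy_le [CompleteSpace E] [MeasurableSpace ι] [MeasurableSingletonClass ι]
    (hV : IsLyapunov Q B V δ) (hκ : ∀ j, ‖V j‖ ≤ κ) {a : ℝ≥0 → ι} (ha : Measurable a)
    {β : ℝ≥0 → E} {x : E} {f : ℝ≥0 → E} (hf : IsSolutionPath (fun s => B (a s)) β x f) {T : ℝ≥0}
    (hβ : IntervalIntegrable (fun u : ℝ => ‖β u.toNNReal‖ ^ 2) volume 0 T) :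
    δ / 2 * ∫ u in (0 : ℝ)..T, ‖f u.toNNReal‖ ^ 2 ≤
      κ * ‖x‖ ^ 2 + 2 * κ ^ 2 / δ * (∫ u in (0 : ℝ)..T, ‖β u.toNNReal‖ ^ 2) +
        dynkinIntegral Q a T (fun k => ⟪V k x, x⟫)
          (fun k t => 2 * ⟪V k (f t), B (a t) (f t) + β t⟫) := by
  have form_continuous (k : ι) : Continuous fun t => ⟪V k (f t), f t⟫ :=
    ((V k).continuous.comp hf.continuous).inner hf.continuous
  have current_integrable := intervalIntegrable_apply (φ := fun k t => 2 * ⟪V k (f t),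
      B (a t) (f t) + β t⟫) ha (fun k t => hf.intervalIntegrable_two_mul_inner (V k) 0 t) T
  have coupling_integrable := intervalIntegrable_sum_entry_mul (Q := Q) ha form_continuous 0 T
  have path_integrable : IntervalIntegrable (fun u : ℝ => ‖f u.toNNReal‖ ^ 2) volume 0 T :=
    ((hf.continuous.comp continuous_real_toNNReal).norm.pow 2).intervalIntegrable _ _
  have dynkin := apply_sub_apply_sub_integral_eq (Q := Q) (Φ := fun k t => ⟪V k (f t), f t⟫)
    (φ := fun k t => 2 * ⟪V k (f t), B (a t) (f t) + β t⟫) ha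
    (fun k t => hf.intervalIntegrable_two_mul_inner (V k) 0 t)
    (fun k => hf.inner_apply_self_eq (hV.isPositive k).isSymmetric) T
  have drift_integral_le := intervalIntegral.integral_mono_on T.coe_nonneg
    (current_integrable.add coupling_integrable)
    ((hβ.const_mul (2 * κ ^ 2 / δ)).sub (path_integrable.const_mul (δ / 2)))
    fun u _ => hV.drift_le hκ (a u.toNNReal) (f u.toNNReal) (β u.toNNReal)
  rw [intervalIntegral.integral_sub (hβ.const_mul _) (path_integrable.const_mul _),
    intervalIntegral.integral_const_mul, intervalIntegral.integral_const_mul] at drift_integral_le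
  have final_nonneg := (hV.isPositive (a T)).inner_nonneg_left (f T)
  have initial_le : ⟪V (a 0) x, x⟫ ≤ κ * ‖x‖ ^ 2 := by
    rw [sq, ← mul_assoc]
    exact (real_inner_le_norm _ _).trans
      (mul_le_mul_of_nonneg_right ((V (a 0)).le_of_opNorm_le (hκ _) x) (norm_nonneg _))
  simp only [hf.apply_zero] at dynkin
  linarith

end IsLyapunov

end Lyapunov

section SquareIntegrable

theorem intervalIntegrable_of_memLp_two {F : Type*} [NormedAddCommGroup F] {f : ℝ → F}
    (hf : MemLp f 2 (volume.restrict (Set.Ioi 0))) {T : ℝ} (hT : 0 ≤ T) :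
    IntervalIntegrable f volume 0 T :=
  (intervalIntegrable_iff_integrableOn_Ioc_of_le hT).2
    ((hf.mono_measure (Measure.restrict_mono_set _ Set.Ioc_subset_Ioi_self)).integrable one_le_two)

theorem intervalIntegrable_sq_norm_of_memLp_two {F : Type*} [NormedAddCommGroup F] {f : ℝ → F}
    (hf : MemLp f 2 (volume.restrict (Set.Ioi 0))) {T : ℝ} (hT : 0 ≤ T) :
    IntervalIntegrable (fun u => ‖f u‖ ^ 2) volume 0 T :=
  (intervalIntegrable_iff_integrableOn_Ioc_of_le hT).2
    (IntegrableOn.mono_set (hf.integrable_norm_pow two_ne_zero) Set.Ioc_subset_Ioi_self)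

variable {Ω : Type*} {mΩ : MeasurableSpace Ω} {P : Measure Ω} {𝔽 : Filtration ℝ≥0 mΩ}
  {E : Type*} [NormedAddCommGroup E] [MeasurableSpace E]

/-- The space `L²_𝔽(E)` for an arbitrary filtration and state space. Time runs through `(0, ∞)`,
and square integrability is with respect to the product measure on `(0, ∞) × Ω`. -/
structure MemL2Process (P : Measure Ω) (𝔽 : Filtration ℝ≥0 mΩ) (φ : ℝ≥0 → Ω → E) : Prop where
  isProgressive : IsProgressive 𝔽 φ
  memLp : MemLp (fun p : ℝ × Ω => φ p.1.toNNReal p.2) 2 ((volume.restrict (Set.Ioi 0)).prod P)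

theorem aestronglyMeasurable_of_isProgressive [BorelSpace E] [SecondCountableTopology E]
    {φ : ℝ≥0 → Ω → E} (hφ : IsProgressive 𝔽 φ) (ν : Measure (ℝ × Ω)) :
    AEStronglyMeasurable (fun p : ℝ × Ω => φ p.1.toNNReal p.2) ν :=
  ((measurable_uncurry_of_isProgressive hφ).comp
    (measurable_real_toNNReal.prodMap measurable_id)).aestronglyMeasurable

theorem memL2F_iff [SFinite P] {n : ℕ} {φ : ℝ≥0 → Ω → EuclideanSpace ℝ (Fin n)} :
    MemL2F P 𝔽 φ ↔ MemL2Process P 𝔽 φ := by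
  have lintegral_eq (hφ : IsProgressive 𝔽 φ) :
      ∫⁻ ω, (∫⁻ t in Set.Ici (0 : ℝ), ‖φ t.toNNReal ω‖ₑ ^ 2) ∂P =
        ∫⁻ p : ℝ × Ω, ‖φ p.1.toNNReal p.2‖ₑ ^ (2 : ℝ≥0∞).toReal
          ∂((volume.restrict (Set.Ioi 0)).prod P) := by
    rw [lintegral_prod_symm _ ((aestronglyMeasurable_of_isProgressive hφ _).enorm.pow_const _),
      Measure.restrict_congr_set Ioi_ae_eq_Ici]
    simp only [ENNReal.toReal_ofNat, ENNReal.rpow_ofNat]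
  constructor
  · rintro ⟨progressive, finite⟩
    refine ⟨progressive, aestronglyMeasurable_of_isProgressive progressive _, ?_⟩
    rwa [eLpNorm_lt_top_iff_lintegral_rpow_enorm_lt_top two_ne_zero ENNReal.ofNat_ne_top,
      ← lintegral_eq progressive]
  · rintro ⟨progressive, memLp⟩
    refine ⟨progressive, ?_⟩
    rw [lintegral_eq progressive]
    exact (eLpNorm_lt_top_iff_lintegral_rpow_enorm_lt_top two_ne_zero ENNReal.ofNat_ne_top).1
      memLp.eLpNorm_lt_top

namespace MemL2Process

variable {φ : ℝ≥0 → Ω → E}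

theorem ae_memLp [SFinite P] [BorelSpace E] [SecondCountableTopology E]
    (hφ : MemL2Process P 𝔽 φ) :
    ∀ᵐ ω ∂P, MemLp (fun t : ℝ => φ t.toNNReal ω) 2 (volume.restrict (Set.Ioi 0)) := by
  have path_measurable (ω : Ω) : Measurable fun t : ℝ => φ t.toNNReal ω :=
    (measurable_uncurry_of_isProgressive hφ.isProgressive).comp
      (measurable_real_toNNReal.prodMk measurable_const)
  filter_upwards [(hφ.memLp.integrable_norm_pow two_ne_zero).prod_left_ae] with ω hω
  exact (memLp_two_iff_integrable_sq_norm (path_measurable ω).aestronglyMeasurable).2 hω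

theorem memLp_Ioc [SFinite P] (hφ : MemL2Process P 𝔽 φ) (T : ℝ) :
    MemLp (fun p : ℝ × Ω => φ p.1.toNNReal p.2) 2 ((volume.restrict (Set.Ioc 0 T)).prod P) :=
  hφ.memLp.mono_measure
    (Measure.prod_mono (Measure.restrict_mono_set _ Set.Ioc_subset_Ioi_self) le_rfl)

theorem of_setIntegral_le [BorelSpace E] [SecondCountableTopology E] [SFinite P]
    (hφ : IsProgressive 𝔽 φ) {C : ℝ}
    (hφT : ∀ T : ℝ≥0, MemLp (fun p : ℝ × Ω => φ p.1.toNNReal p.2) 2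
      ((volume.restrict (Set.Ioc 0 (T : ℝ))).prod P))
    (hC : ∀ T : ℝ≥0, ∫ p : ℝ × Ω, ‖φ p.1.toNNReal p.2‖ ^ 2
      ∂((volume.restrict (Set.Ioc 0 (T : ℝ))).prod P) ≤ C) : MemL2Process P 𝔽 φ := by
  have slab_eq (N : ℕ) : ((volume.restrict (Set.Ioi 0)).prod P).restrict
      (Set.Iic (N : ℝ) ×ˢ Set.univ) = (volume.restrict (Set.Ioc 0 ((N : ℝ≥0) : ℝ))).prod P := by
    rw [← Measure.restrict_prod_eq_prod_univ, Measure.restrict_restrict measurableSet_Iic,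
      Set.inter_comm, Set.Ioi_inter_Iic, NNReal.coe_natCast]
  have cover : AECover ((volume.restrict (Set.Ioi (0 : ℝ))).prod P) atTop
      fun N : ℕ => Set.Iic (N : ℝ) ×ˢ (Set.univ : Set Ω) :=
    ⟨ae_of_all _ fun p : ℝ × Ω => (tendsto_natCast_atTop_atTop.eventually_ge_atTop p.1).mono
      fun _ hN => ⟨hN, trivial⟩, fun _ => measurableSet_Iic.prod MeasurableSet.univ⟩
  refine ⟨hφ, (memLp_two_iff_integrable_sq_norm (aestronglyMeasurable_of_isProgressive hφ _)).2
    (cover.integrable_of_integral_norm_bounded C (fun N => ?_) (Eventually.of_forall fun N => ?_))⟩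
  · rw [IntegrableOn, slab_eq]
    exact (hφT N).integrable_norm_pow two_ne_zero
  · rw [slab_eq]
    simpa only [norm_pow, norm_norm] using hC N

end MemL2Process

end SquareIntegrable

section MeanEnergy

open scoped RealInnerProductSpace

theorem integrable_inner_of_memLp_two {Y E : Type*} {mY : MeasurableSpace Y} {ν : Measure Y}
    [NormedAddCommGroup E] [InnerProductSpace ℝ E] {f g : Y → E} (hf : MemLp f 2 ν)
    (hg : MemLp g 2 ν) : Integrable (fun y => ⟪f y, g y⟫) ν :=
  memLp_one_iff_integrable.1 (MemLp.of_bilin (fun v w : E => ⟪v, w⟫) 1 hf hg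
    (hf.1.inner hg.1) (ae_of_all _ fun y => by simpa using nnnorm_inner_le_nnnorm _ _))

theorem memLp_two_apply_coeff {ι : Type*} [Finite ι] [MeasurableSpace ι]
    [MeasurableSingletonClass ι] {E : Type*} [NormedAddCommGroup E] [NormedSpace ℝ E]
    (B : ι → E →L[ℝ] E) {Y : Type*} {mY : MeasurableSpace Y} {ν : Measure Y} {j : Y → ι}
    (hj : Measurable j) {f : Y → E} (hf : MemLp f 2 ν) : MemLp (fun y => B (j y) (f y)) 2 ν := by
  obtain ⟨K, hK⟩ := Finite.exists_le fun j => ‖B j‖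
  have coeff_measurable : StronglyMeasurable fun y => B (j y) :=
    (StronglyMeasurable.of_discrete (f := B)).comp_measurable hj
  exact hf.of_le_mul (isBoundedBilinearMap_apply.continuous.comp_aestronglyMeasurable
      (coeff_measurable.aestronglyMeasurable.prodMk hf.1))
    (ae_of_all _ fun y => (B (j y)).le_of_opNorm_le (hK _) _)

variable {Ω : Type*} {mΩ : MeasurableSpace Ω} {P : Measure Ω} [IsFiniteMeasure P]
  {𝔽 : Filtration ℝ≥0 mΩ} {ι : Type*} [MeasurableSpace ι] {α : ℝ≥0 → Ω → ι} {E : Type*}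
  [NormedAddCommGroup E] [MeasurableSpace E] {b X : ℝ≥0 → Ω → E} {ξ : Ω → E}

theorem memLp_Ioc_of_isSolutionPath [Finite ι] [MeasurableSingletonClass ι] [NormedSpace ℝ E]
    [CompleteSpace E] [BorelSpace E] [SecondCountableTopology E] {B : ι → E →L[ℝ] E}
    (hα : Measurable fun p : ℝ≥0 × Ω => α p.1 p.2) (hb : MemL2Process P 𝔽 b) (hξ : MemLp ξ 2 P)
    (hX : IsProgressive 𝔽 X)
    (hsol : ∀ᵐ ω ∂P, IsSolutionPath (fun s => B (α s ω)) (b · ω) (ξ ω) (X · ω)) (T : ℝ≥0) :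
    MemLp (fun p : ℝ × Ω => X p.1.toNNReal p.2) 2
      ((volume.restrict (Set.Ioc 0 (T : ℝ))).prod P) := by
  obtain ⟨K, hK⟩ := Finite.exists_le fun j => ‖B j‖
  let bound (ω : Ω) : ℝ := 2 * (‖ξ ω‖ ^ 2 + T * ∫ s in (0 : ℝ)..T, ‖b s.toNNReal ω‖ ^ 2) *
    Real.exp (K * T) ^ 2
  have bound_integrable : Integrable bound P := by
    simp only [bound, intervalIntegral.integral_of_le T.coe_nonneg]
    exact (((hξ.integrable_norm_pow two_ne_zero).add (((hb.memLp_Ioc T).integrable_norm_pow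
      two_ne_zero).integral_prod_right.const_mul _)).const_mul 2).mul_const _
  have sq_norm_le : ∀ᵐ ω ∂P, ∀ t ≤ T, ‖X t ω‖ ^ 2 ≤ bound ω := by
    filter_upwards [hsol, hb.ae_memLp] with ω hω hbω t ht
    exact hω.sq_norm_le ((StronglyMeasurable.of_discrete (f := B)).comp_measurable
      (hα.comp measurable_prodMk_right)) (fun s => hK _)
      (fun s => intervalIntegrable_of_memLp_two hbω s.coe_nonneg)
      (fun s => intervalIntegrable_sq_norm_of_memLp_two hbω s.coe_nonneg) ht
  have X_measurable := aestronglyMeasurable_of_isProgressive hX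
    ((volume.restrict (Set.Ioc 0 (T : ℝ))).prod P)
  refine (memLp_two_iff_integrable_sq_norm X_measurable).2
    ((bound_integrable.comp_snd _).mono' (X_measurable.norm.pow 2) ?_)
  filter_upwards [Measure.quasiMeasurePreserving_snd.ae sq_norm_le,
    Measure.quasiMeasurePreserving_fst.ae (ae_restrict_mem measurableSet_Ioc)] with p hp hp_mem
  rw [Real.norm_of_nonneg (sq_nonneg _)]
  exact hp _ (Real.toNNReal_le_iff_le_coe.2 hp_mem.2)

variable [InnerProductSpace ℝ E] {B V : ι → E →L[ℝ] E}

theorem integrable_inner_velocity [Finite ι] [MeasurableSingletonClass ι]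
    (hα : Measurable fun p : ℝ≥0 × Ω => α p.1 p.2) (hb : MemL2Process P 𝔽 b) {T : ℝ≥0}
    (hX : MemLp (fun p : ℝ × Ω => X p.1.toNNReal p.2) 2
      ((volume.restrict (Set.Ioc 0 (T : ℝ))).prod P)) (S : E →L[ℝ] E) :
    Integrable (fun p : ℝ × Ω => 2 * ⟪S (X p.1.toNNReal p.2),
        B (α p.1.toNNReal p.2) (X p.1.toNNReal p.2) + b p.1.toNNReal p.2⟫)
      ((volume.restrict (Set.Ioc 0 (T : ℝ))).prod P) :=
  (integrable_inner_of_memLp_two (S.comp_memLp' hX) ((memLp_two_apply_coeff B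
    (hα.comp (measurable_real_toNNReal.prodMap measurable_id)) hX).add
      (hb.memLp_Ioc T))).const_mul 2

variable [BorelSpace E] [SecondCountableTopology E]

theorem stronglyMeasurable_inner_velocity [Countable ι] [MeasurableSingletonClass ι]
    (hα : ∀ t, Measurable[𝔽 t] (α t)) (hb : IsProgressive 𝔽 b) (hX : IsProgressive 𝔽 X)
    (S : E →L[ℝ] E) (t : ℝ≥0) :
    StronglyMeasurable[𝔽 t] fun ω => 2 * ⟪S (X t ω), B (α t ω) (X t ω) + b t ω⟫ :=
  ((S.continuous.comp_stronglyMeasurable (hX.adapted t).stronglyMeasurable).inner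
    (((measurable_apply_coeff B).comp
      ((hα t).prodMk (hX.adapted t))).stronglyMeasurable.add
        (hb.adapted t).stronglyMeasurable)).const_mul 2

namespace IsLyapunov

variable [Fintype ι] [DecidableEq ι] [TopologicalSpace ι] [DiscreteTopology ι] [BorelSpace ι]
  [CompleteSpace E] {Q : Matrix ι ι ℝ} {δ κ : ℝ}

theorem mean_energy_le (hV : IsLyapunov Q B V δ) (hκ : ∀ j, ‖V j‖ ≤ κ)
    (hM : HasMarkovProperty P 𝔽 Q α) (hα : IsProgressive 𝔽 α) (hb : MemL2Process P 𝔽 b)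
    (hξ : StronglyMeasurable[𝔽 0] ξ) (hξ₂ : MemLp ξ 2 P) (hX : IsProgressive 𝔽 X)
    (hsol : ∀ᵐ ω ∂P, IsSolutionPath (fun s => B (α s ω)) (b · ω) (ξ ω) (X · ω)) (T : ℝ≥0) :
    δ / 2 * ∫ p : ℝ × Ω, ‖X p.1.toNNReal p.2‖ ^ 2 ∂((volume.restrict (Set.Ioc 0 (T : ℝ))).prod P) ≤
      κ * (∫ ω, ‖ξ ω‖ ^ 2 ∂P) + 2 * κ ^ 2 / δ * ∫ p : ℝ × Ω, ‖b p.1.toNNReal p.2‖ ^ 2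
        ∂((volume.restrict (Set.Ioc 0 (T : ℝ))).prod P) := by
  have hα' := measurable_uncurry_of_isProgressive hα
  have hX₂ := memLp_Ioc_of_isSolutionPath hα' hb hξ₂ hX hsol T
  have X_sq_integrable := hX₂.integrable_norm_pow two_ne_zero
  have b_sq_integrable := (hb.memLp_Ioc T).integrable_norm_pow two_ne_zero
  have ξ_sq_integrable := hξ₂.integrable_norm_pow two_ne_zero
  have initial_integrable (k : ι) : Integrable (fun ω => ⟪V k (ξ ω), ξ ω⟫) P :=
    integrable_inner_of_memLp_two ((V k).comp_memLp' hξ₂) hξ₂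
  let current (k : ι) (t : ℝ≥0) (ω : Ω) : ℝ := 2 * ⟪V k (X t ω), B (α t ω) (X t ω) + b t ω⟫
  have current_integrable (k : ι) := integrable_inner_velocity (B := B) hα' hb hX₂ (V k)
  let noise (ω : Ω) : ℝ :=
    dynkinIntegral Q (α · ω) T (fun k => ⟪V k (ξ ω), ξ ω⟫) (current · · ω)
  have noise_integrable : Integrable noise P :=
    integrable_dynkinIntegral hα' initial_integrable current_integrable
  have noise_mean : ∫ ω, noise ω ∂P = 0 :=
    hM.integral_dynkinIntegral hα'
      (fun k => ((V k).continuous.comp_stronglyMeasurable hξ).inner hξ) initial_integrable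
      (fun k => stronglyMeasurable_inner_velocity hα.adapted hb.isProgressive hX (V k))
      current_integrable
  have energy_le : ∀ᵐ ω ∂P, δ / 2 * ∫ u in Set.Ioc 0 (T : ℝ), ‖X u.toNNReal ω‖ ^ 2 ≤
      κ * ‖ξ ω‖ ^ 2 + 2 * κ ^ 2 / δ * (∫ u in Set.Ioc 0 (T : ℝ), ‖b u.toNNReal ω‖ ^ 2) +
        noise ω := by
    simp only [← intervalIntegral.integral_of_le T.coe_nonneg]
    filter_upwards [hsol, hb.ae_memLp] with ω hω hbω
    exact hV.energy_le hκ (hα'.comp measurable_prodMk_right) hω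
      (intervalIntegrable_sq_norm_of_memLp_two hbω T.coe_nonneg)
  have data_integrable := (ξ_sq_integrable.const_mul κ).add
    (b_sq_integrable.integral_prod_right.const_mul (2 * κ ^ 2 / δ))
  have mean_le := integral_mono_ae (X_sq_integrable.integral_prod_right.const_mul (δ / 2))
    (data_integrable.add noise_integrable) energy_le
  rwa [integral_add' data_integrable noise_integrable, noise_mean, add_zero,
    integral_add' (ξ_sq_integrable.const_mul κ)
      (b_sq_integrable.integral_prod_right.const_mul (2 * κ ^ 2 / δ)),
    integral_const_mul, integral_const_mul, integral_const_mul,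
    ← integral_prod_symm _ X_sq_integrable, ← integral_prod_symm _ b_sq_integrable] at mean_le

theorem memL2Process (hV : IsLyapunov Q B V δ) (hM : HasMarkovProperty P 𝔽 Q α)
    (hα : IsProgressive 𝔽 α) (hb : MemL2Process P 𝔽 b) (hξ : StronglyMeasurable[𝔽 0] ξ)
    (hξ₂ : MemLp ξ 2 P) (hX : IsProgressive 𝔽 X)
    (hsol : ∀ᵐ ω ∂P, IsSolutionPath (fun s => B (α s ω)) (b · ω) (ξ ω) (X · ω)) :
    MemL2Process P 𝔽 X := by
  obtain ⟨κ, hκ⟩ := Finite.exists_le fun j => ‖V j‖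
  have hδ := hV.pos
  let total : ℝ := ∫ p : ℝ × Ω, ‖b p.1.toNNReal p.2‖ ^ 2 ∂((volume.restrict (Set.Ioi 0)).prod P)
  refine .of_setIntegral_le (C := (κ * (∫ ω, ‖ξ ω‖ ^ 2 ∂P) + 2 * κ ^ 2 / δ * total) / (δ / 2)) hX
    (memLp_Ioc_of_isSolutionPath (measurable_uncurry_of_isProgressive hα) hb hξ₂ hX hsol)
    fun T => ?_
  have forcing_le : ∫ p : ℝ × Ω, ‖b p.1.toNNReal p.2‖ ^ 2
      ∂((volume.restrict (Set.Ioc 0 (T : ℝ))).prod P) ≤ total :=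
    integral_mono_measure
      (Measure.prod_mono (Measure.restrict_mono_set _ Set.Ioc_subset_Ioi_self) le_rfl)
      (ae_of_all _ fun _ => sq_nonneg _) (hb.memLp.integrable_norm_pow two_ne_zero)
  rw [le_div_iff₀' (half_pos hδ)]
  refine (hV.mean_energy_le hκ hM hα hb hξ hξ₂ hX hsol T).trans ?_
  gcongr

end IsLyapunov

end MeanEnergy

section Coercivity

open scoped RealInnerProductSpace

variable {E : Type*} [NormedAddCommGroup E] [InnerProductSpace ℝ E] [FiniteDimensional ℝ E]

theorem exists_pos_mul_sq_norm_le_inner {S : E →L[ℝ] E} (hS : ∀ v ≠ 0, 0 < ⟪S v, v⟫) :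
    ∃ δ > 0, ∀ v, δ * ‖v‖ ^ 2 ≤ ⟪S v, v⟫ := by
  rcases subsingleton_or_nontrivial E with _ | _
  · exact ⟨1, one_pos, fun v => by simp [Subsingleton.elim v 0]⟩
  obtain ⟨w, hw, w_min⟩ := (isCompact_sphere (0 : E) 1).exists_isMinOn
    (NormedSpace.sphere_nonempty.2 zero_le_one)
    (S.continuous.inner (𝕜 := ℝ) continuous_id).continuousOn
  refine ⟨⟪S w, w⟫, hS w (ne_zero_of_mem_unit_sphere ⟨w, hw⟩), fun v => ?_⟩
  rcases eq_or_ne v 0 with rfl | hv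
  · simp
  have unit_le : ⟪S w, w⟫ ≤ ⟪S (‖v‖⁻¹ • v), ‖v‖⁻¹ • v⟫ := w_min (by simp [norm_smul, hv])
  rw [map_smul, real_inner_smul_left, real_inner_smul_right] at unit_le
  have norm_ne_zero := norm_ne_zero_iff.2 hv
  calc ⟪S w, w⟫ * ‖v‖ ^ 2 ≤ ‖v‖⁻¹ * (‖v‖⁻¹ * ⟪S v, v⟫) * ‖v‖ ^ 2 := by gcongr
    _ = ⟪S v, v⟫ := by field_simp

theorem exists_forall_pos_mul_sq_norm_le_inner {ι : Type*} [Finite ι] {S : ι → E →L[ℝ] E}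
    (hS : ∀ j, ∀ v ≠ 0, 0 < ⟪S j v, v⟫) : ∃ δ > 0, ∀ j v, δ * ‖v‖ ^ 2 ≤ ⟪S j v, v⟫ := by
  choose δ δ_pos hδ using fun j => exists_pos_mul_sq_norm_le_inner (hS j)
  rcases isEmpty_or_nonempty ι with _ | _
  · exact ⟨1, one_pos, isEmptyElim⟩
  obtain ⟨i, i_min⟩ := Finite.exists_min δ
  exact ⟨δ i, δ_pos i, fun j v =>
    (mul_le_mul_of_nonneg_right (i_min j) (sq_nonneg _)).trans (hδ j v)⟩

end Coercivity

section ConditionA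

open Matrix (toEuclideanCLM)
open scoped RealInnerProductSpace

theorem inner_toEuclideanCLM_pos {ι : Type*} [Fintype ι] [DecidableEq ι] {N : Matrix ι ι ℝ}
    (hN : N.PosDef) {v : EuclideanSpace ℝ ι} (hv : v ≠ 0) :
    0 < ⟪toEuclideanCLM (𝕜 := ℝ) N v, v⟫ := by
  rw [real_inner_comm, Matrix.inner_toEuclideanCLM]
  simpa using hN.dotProduct_mulVec_pos (x := v.ofLp) (by simpa using hv)

theorem isPositive_toEuclideanCLM {ι : Type*} [Fintype ι] [DecidableEq ι] {N : Matrix ι ι ℝ}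
    (hN : N.PosSemidef) : (toEuclideanCLM (𝕜 := ℝ) N).IsPositive :=
  LinearMap.isPositive_toContinuousLinearMap_iff _ |>.2 (Matrix.isPositive_toEuclideanLin_iff.2 hN)

theorem inner_toEuclideanCLM_lyapunov {ι : Type*} [Fintype ι] [DecidableEq ι] {N : Matrix ι ι ℝ}
    (hN : N.IsHermitian) (A R : Matrix ι ι ℝ) (v : EuclideanSpace ℝ ι) :
    ⟪toEuclideanCLM (𝕜 := ℝ) (N * A + A.transpose * N + R) v, v⟫ =
      2 * ⟪toEuclideanCLM (𝕜 := ℝ) N v, toEuclideanCLM (𝕜 := ℝ) A v⟫ +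
        ⟪toEuclideanCLM (𝕜 := ℝ) R v, v⟫ := by
  have symmetric : (toEuclideanCLM (𝕜 := ℝ) N).IsSymmetric :=
    Matrix.isSymmetric_toEuclideanLin_iff.2 hN
  have inner_mul : ⟪toEuclideanCLM (𝕜 := ℝ) (N * A) v, v⟫ =
      ⟪toEuclideanCLM (𝕜 := ℝ) N v, toEuclideanCLM (𝕜 := ℝ) A v⟫ := by
    rw [map_mul, mul_apply_eq_comp, real_inner_comm]
    exact (symmetric _ _).symm
  have inner_transpose_mul : ⟪toEuclideanCLM (𝕜 := ℝ) (A.transpose * N) v, v⟫ =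
      ⟪toEuclideanCLM (𝕜 := ℝ) N v, toEuclideanCLM (𝕜 := ℝ) A v⟫ := by
    rw [← Matrix.conjTranspose_eq_transpose_of_trivial, ← Matrix.star_eq_conjTranspose, map_mul,
      map_star, mul_apply_eq_comp, ContinuousLinearMap.star_eq_adjoint,
      ContinuousLinearMap.adjoint_inner_left]
  rw [map_add, map_add, add_apply, add_apply, inner_add_left, inner_add_left,
    inner_mul, inner_transpose_mul, two_mul]

theorem ConditionA.exists_isLyapunov {D n : ℕ} {Q : Matrix (Fin D) (Fin D) ℝ}
    {A : Fin D → Matrix (Fin n) (Fin n) ℝ} (hA : ConditionA Q A) :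
    ∃ V δ, IsLyapunov Q (fun j => toEuclideanCLM (𝕜 := ℝ) (A j)) V δ := by
  obtain ⟨M, M_posDef, drift_negDef⟩ := hA
  obtain ⟨δ, δ_pos, hδ⟩ := exists_forall_pos_mul_sq_norm_le_inner fun j v hv =>
    inner_toEuclideanCLM_pos (drift_negDef j) hv
  refine ⟨fun j => toEuclideanCLM (𝕜 := ℝ) (M j), δ, δ_pos,
    fun j => isPositive_toEuclideanCLM (M_posDef j).posSemidef, fun j v => ?_⟩
  have drift_ge := hδ j v
  rw [map_neg, neg_apply, inner_neg_left,
    inner_toEuclideanCLM_lyapunov (M_posDef j).isHermitian, map_sum] at drift_ge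
  simp only [map_smul, sum_apply, smul_apply, sum_inner, real_inner_smul_left] at drift_ge
  linarith

end ConditionA

section AugmentedFiltration

variable {Ω : Type*} {mΩ : MeasurableSpace Ω} {P : Measure Ω} {D : ℕ} {α : ℝ≥0 → Ω → Fin D}

theorem measurableSet_augmentedFiltration_of_null (hα : ∀ t, Measurable (α t)) (t : ℝ≥0)
    {N : Set Ω} (hN : MeasurableSet N) (hPN : P N = 0) :
    MeasurableSet[augmentedFiltration P α hα t] N :=
  le_sup_right (a := (Filtration.natural α fun s => (hα s).stronglyMeasurable) t) N
    (MeasurableSpace.measurableSet_generateFrom ⟨hN, hPN⟩)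

theorem measurable_augmentedFiltration (hα : ∀ t, Measurable (α t)) (t : ℝ≥0) :
    Measurable[augmentedFiltration P α hα t] (α t) :=
  (Filtration.stronglyAdapted_natural fun s => (hα s).stronglyMeasurable) t |>.measurable.mono
    le_sup_left le_rfl

end AugmentedFiltration

end RegimeSwitching

end

open RegimeSwitching in
theorem mainTheorem4_general {Ω : Type*} {mΩ : MeasurableSpace Ω} {P : Measure Ω}
    [IsFiniteMeasure P] {𝔽 : Filtration ℝ≥0 mΩ}
    (h𝔽 : ∀ N, MeasurableSet N → P N = 0 → MeasurableSet[𝔽 0] N) {ι : Type*} [Fintype ι]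
    [DecidableEq ι] [MeasurableSpace ι] [TopologicalSpace ι] [DiscreteTopology ι] [BorelSpace ι]
    {Q : Matrix ι ι ℝ} {α : ℝ≥0 → Ω → ι} (hα : ∀ t, Measurable[𝔽 t] (α t))
    (hM : HasMarkovProperty P 𝔽 Q α)
    (hcont : ∀ᵐ ω ∂P, ∀ t, ContinuousWithinAt (fun s => α s ω) (Set.Ioi t) t) {E : Type*}
    [NormedAddCommGroup E] [InnerProductSpace ℝ E] [CompleteSpace E] [MeasurableSpace E]
    [BorelSpace E] [SecondCountableTopology E] {B V : ι → E →L[ℝ] E} {δ : ℝ}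
    (hV : IsLyapunov Q B V δ) {b : ℝ≥0 → Ω → E}
    (hb : MemL2Process P 𝔽 b) {ξ : Ω → E} (hξ : StronglyMeasurable[𝔽 0] ξ)
    (hξ₂ : MemLp ξ 2 P) :
    ∃ X : ℝ≥0 → Ω → E, MemL2Process P 𝔽 X ∧
      (∀ᵐ ω ∂P, IsSolutionPath (fun s => B (α s ω)) (b · ω) (ξ ω) (X · ω)) ∧
      ∀ Y : ℝ≥0 → Ω → E,
        (∀ᵐ ω ∂P, IsSolutionPath (fun s => B (α s ω)) (b · ω) (ξ ω) (Y · ω)) →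
        ∀ᵐ ω ∂P, ∀ t, Y t ω = X t ω := by
  obtain ⟨K, hK⟩ := Finite.exists_le fun j => ‖B j‖
  obtain ⟨β, β_progressive, β_eq⟩ := exists_isProgressive_ae_eq h𝔽 hα hcont
  let X (t : ℝ≥0) (ω : Ω) : E := picardSum (fun s => B (β s ω))
    (fun s => ξ ω + ∫ r in (0 : ℝ)..s, b r.toNNReal ω) t
  have X_progressive : IsProgressive 𝔽 X :=
    isProgressive_picardSum B β_progressive <|
      .add (fun T => (hξ.measurable.mono (𝔽.mono zero_le) le_rfl).comp measurable_snd)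
        (isProgressive_integral hb.isProgressive)
  have X_solution : ∀ᵐ ω ∂P, IsSolutionPath (fun s => B (β s ω)) (b · ω) (ξ ω) (X · ω) := by
    filter_upwards [hb.ae_memLp] with ω hω
    exact .picardSum ((StronglyMeasurable.of_discrete (f := B)).comp_measurable
      ((measurable_uncurry_of_isProgressive β_progressive).comp measurable_prodMk_right))
      (fun s => hK _) (fun t => intervalIntegrable_of_memLp_two hω t.coe_nonneg) _
  refine ⟨X, hV.memL2Process (hM.congr β_eq) β_progressive hb hξ hξ₂ X_progressive X_solution,
    ?_, fun Y hY => ?_⟩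
  · filter_upwards [X_solution, β_eq] with ω hω hβ
    simpa only [hβ] using hω
  · filter_upwards [X_solution, hY, β_eq] with ω hXω hYω hβ t
    simp only [hβ] at hXω
    exact congrFun (hYω.eq (fun s => hK _) hXω) t

theorem mainTheorem4 {Ω : Type*} {mΩ : MeasurableSpace Ω} (P : Measure Ω)
    [IsProbabilityMeasure P] [P.IsComplete] {D n : ℕ}
    (Q : Matrix (Fin D) (Fin D) ℝ)
    (α : ℝ≥0 → Ω → Fin D) (hα : ∀ t, Measurable (α t))
    (hchain : RegimeSwitching.IsMarkovChain P Q α hα)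
    (A : Fin D → Matrix (Fin n) (Fin n) ℝ)
    (hA : RegimeSwitching.ConditionA Q A)
    (b : ℝ≥0 → Ω → EuclideanSpace ℝ (Fin n))
    (hb : RegimeSwitching.MemL2F P (RegimeSwitching.augmentedFiltration P α hα) b)
    (x : EuclideanSpace ℝ (Fin n)) (i : Fin D) (hi : ∀ᵐ ω ∂P, α 0 ω = i) :
    ∃ X : ℝ≥0 → Ω → EuclideanSpace ℝ (Fin n),
      RegimeSwitching.MemL2F P (RegimeSwitching.augmentedFiltration P α hα) X ∧
      RegimeSwitching.IsSolution P A α b x X ∧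
      ∀ Y : ℝ≥0 → Ω → EuclideanSpace ℝ (Fin n),
        RegimeSwitching.IsSolution P A α b x Y → ∀ᵐ ω ∂P, ∀ t, Y t ω = X t ω := by
  obtain ⟨V, δ, hV⟩ := hA.exists_isLyapunov
  simp only [RegimeSwitching.memL2F_iff] at hb ⊢
  exact mainTheorem4_general
    (fun _ => RegimeSwitching.measurableSet_augmentedFiltration_of_null hα 0)
    (RegimeSwitching.measurable_augmentedFiltration hα) hchain.markov
    (hchain.cadlag.mono fun _ h t => (h t).1) hV hb stronglyMeasurable_const (memLp_const x)
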